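/- Let $n\ge 0$, $d\ge 1$, let $\Omega\subset\mathbb R^d$ be a bounded open set, let $\mu\ge 0$ be a weight on $\Omega$ with $\int_\Omega\mu\,dx<\infty$, and let $u:\Omega\to\mathbb R$ be measurable with $\int_\Omega \mu u^2\,dx<\infty$. Put $\sigma(t)=\max\{0,t\}$, $H(t)=1$ for $t>0$ and $H(t)=0$ for $t\le 0$, and $y=(1,x_1,\dots,x_d)^T$. For $r=(r_1,\dots,r_n)\in\mathbb R^{n(d+1)}$ with $r_i=(b_i,\omega_i)\in\mathbb R\times\mathbb R^d$, $c_0\in\mathbb R$ and $c\in\mathbb R^n$ let $$u_n(x)=u_n(x;c_0,c,r)=c_0+\sum_{i=1}^n c_i\,\sigma(r_i\cdot y),\qquad J(r)=\tfrac12\int_\Omega \mu\,\big(u_n(x;c_0,c,r)-u(x)\big)^2dx .$$ Let $D(c)=\mathrm{diag}(c_1,\dots,c_n)$, let $\mathbf H(x)=(H(r_1\cdot y),\dots,H(r_n\cdot y))^T$, and let $\Lambda=\mathrm{diag}(\delta_1,\dots,\delta_n)$, where $\delta_i=\delta(r_i\cdot y)$ is the Dirac delta concentrated on the breaking hyperplane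 $P_i=\{x\in\mathbb R^d:\omega_i\cdot x+b_i=0\}$, that is, for $\omega_i\neq0$, $|\omega_i|^{-1}$ times the surface measure of $P_i$ (so just the surface measure when $|\omega_i|=1$). Define $$\mathcal H(r)=\int_\Omega\mu\,[\mathbf H\mathbf H^T]\otimes[yy^T]\,dx,\qquad \hat{\mathcal H}(c,r)=\int_\Omega \mu\,(u_n-u)\,\Lambda\otimes(yy^T)\,dx,$$ where $\hat{\mathcal H}$ also depends on $c_0$ and $dx$ is absorbed in the measures $\delta_i$, and let $\mathcal G(c,r)=\int_\Omega\mu\,(\nabla_r u_n)(\nabla_r u_n)^T\,dx$ be the Gauss–Newton matrix with respect to $r$. Fix $c_0$ and $c$. (1) For every $r$ with all $\omega_i\ne0$ (in particular whenever all $|\omega_i|=1$), $u_n(x;c_0,c,\cdot)$ is differentiable at $r$ for almost every $x\in\Omega$, and $$\mathcal G(c,r)=\big(D(c)\otimes I_{d+1}\big)\,\mathcal H(r)\,\big(D(c)\otimes I_{d+1}\big).$$ (2) For almost every $r\in\mathbb R^{n(d+1)}$ the integrals defining $\hat{\mathcal H}(c,r)$ converge absolutely, and in the weak sense on $\mathbb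 R^{n(d+1)}$ $$\nabla_r\big(\nabla_r J\big)^T=\mathcal G(c,r)+\hat{\mathcal H}(c,r)\big(D(c)\otimes I_{d+1}\big),$$ i.e. $J$ and all entries of the right-hand side $M$ are locally integrable, and $\int J\,\partial_a\partial_b\varphi\,dr=\int M_{ab}\,\varphi\,dr$ for all $\varphi\in C_c^\infty(\mathbb R^{n(d+1)})$ and all indices $a,b$. (3) Suppose moreover that $\mu$ and $u$ are bounded on $\Omega$, and let $r$ be such that for every $i$: $\omega_i\neq0$, the set $P_i\cap\partial\Omega$ has surface measure zero, and $\mu$ and $u$ are continuous at almost every point of $P_i\cap\Omega$ with respect to surface measure. Then the integrals defining $\hat{\mathcal H}(c,r)$ converge absolutely, $J$ is differentiable near $r$, $\nabla_rJ$ is differentiable at $r$, and the identity in (2) holds at $r$ in the classical sense. -/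

import Mathlib

open MeasureTheory Filter Topology
open scoped Kronecker ContDiff

noncomputable section

namespace SgGN

/-- The physical space `ℝᵈ` with its Euclidean norm. -/
abbrev E (d : ℕ) : Type := EuclideanSpace ℝ (Fin d)

/-- The space `ℝ^{n(d+1)}` of hidden-layer parameters `r = (r₁, …, rₙ)`,
where `r (i, 0) = bᵢ` is the bias and `r (i, k + 1) = ω_{ik}` are the weights of the `i`-th neuron.
The index set is the one of a Kronecker product of an `n × n` and a `(d+1) × (d+1)` matrix. -/
abbrev Params (n d : ℕ) : Type := Fin n × Fin (d + 1) → ℝ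

/-- The bias `bᵢ`. -/
def bias {n d : ℕ} (r : Params n d) (i : Fin n) : ℝ := r (i, 0)

/-- The weight vector `ωᵢ ∈ ℝᵈ`. -/
def weight {n d : ℕ} (r : Params n d) (i : Fin n) : E d :=
  WithLp.toLp 2 (fun k : Fin d => r (i, k.succ))

/-- Homogeneous coordinates `y = (1, x₁, …, x_d)`. -/
def homog {d : ℕ} (x : E d) : Fin (d + 1) → ℝ := Fin.cons 1 (fun k : Fin d => x k)

/-- `rᵢ · y = bᵢ + ωᵢ · x`. -/
def preact {n d : ℕ} (r : Params n d) (i : Fin n) (x : E d) : ℝ :=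
  ∑ k, r (i, k) * homog x k

/-- The ReLU activation function. -/
def relu (t : ℝ) : ℝ := max 0 t

/-- The Heaviside step function. -/
def heaviside (t : ℝ) : ℝ := if 0 < t then 1 else 0

/-- The network function `uₙ(x; c₀, c, r) = c₀ + ∑ᵢ cᵢ σ(rᵢ · y)`. -/
def network {n d : ℕ} (c₀ : ℝ) (c : Fin n → ℝ) (r : Params n d) (x : E d) : ℝ :=
  c₀ + ∑ i, c i * relu (preact r i x)

/-- The weighted norm `‖v‖_μ = (∫_Ω μ v² dx)^{1/2}`. -/
def weightedNorm {d : ℕ} (Ω : Set (E d)) (μ v : E d → ℝ) : ℝ :=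
  Real.sqrt (∫ x in Ω, μ x * v x ^ 2)

/-- The least-squares functional `J_μ(v) = ½ ‖v - u‖_μ²`. -/
def lsFunctional {d : ℕ} (Ω : Set (E d)) (μ u v : E d → ℝ) : ℝ :=
  1 / 2 * weightedNorm Ω μ (fun x => v x - u x) ^ 2

/-- The loss `r ↦ J_μ(uₙ(·; c₀, c, r))` as a function of the hidden-layer parameters. -/
def loss {n d : ℕ} (Ω : Set (E d)) (μ u : E d → ℝ) (c₀ : ℝ) (c : Fin n → ℝ)
    (r : Params n d) : ℝ :=
  lsFunctional Ω μ u (network c₀ c r)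

/-- The breaking hyperplane `{x ∈ ℝᵈ : ωᵢ · x + bᵢ = 0}`. -/
def breakingHyperplane {n d : ℕ} (r : Params n d) (i : Fin n) : Set (E d) :=
  {x | preact r i x = 0}

/-- The Dirac delta `δᵢ(x) = δ(rᵢ · y)`, as a measure on `ℝᵈ`: for `ωᵢ ≠ 0` this is
`|ωᵢ|⁻¹` times the surface measure of the breaking hyperplane. -/
def breakingDelta {n d : ℕ} (r : Params n d) (i : Fin n) : Measure (E d) :=
  ENNReal.ofReal (‖weight r i‖⁻¹) •
    (Measure.euclideanHausdorffMeasure (d - 1)).restrict (breakingHyperplane r i)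

/-- The diagonal matrix `Λ = diag(δ₁, …, δₙ)`; its entries are measures. -/
def deltaMatrix {n d : ℕ} (r : Params n d) : Matrix (Fin n) (Fin n) (Measure (E d)) :=
  Matrix.diagonal (fun i => breakingDelta r i)

/-- The vector `H(x) = (H₁(x), …, Hₙ(x))`, `Hᵢ(x) = H(rᵢ · y)`. -/
def heavisideVec {n d : ℕ} (r : Params n d) (x : E d) : Fin n → ℝ :=
  fun i => heaviside (preact r i x)

/-- The matrix `D(c) ⊗ I_{d+1}`. -/
def scaling {n : ℕ} (d : ℕ) (c : Fin n → ℝ) :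
    Matrix (Fin n × Fin (d + 1)) (Fin n × Fin (d + 1)) ℝ :=
  Matrix.diagonal c ⊗ₖ (1 : Matrix (Fin (d + 1)) (Fin (d + 1)) ℝ)

/-- The layer Gauss-Newton matrix `∫_Ω μ (H Hᵀ) ⊗ (y yᵀ) dx`. -/
def layerGN {n d : ℕ} (Ω : Set (E d)) (μ : E d → ℝ) (r : Params n d) :
    Matrix (Fin n × Fin (d + 1)) (Fin n × Fin (d + 1)) ℝ :=
  Matrix.of fun a b => ∫ x in Ω, μ x *
    (Matrix.vecMulVec (heavisideVec r x) (heavisideVec r x) ⊗ₖ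
      Matrix.vecMulVec (homog x) (homog x)) a b

/-- The residual matrix `∫_Ω μ (uₙ - u) Λ ⊗ (y yᵀ) dx`: the `((i,k),(j,l))` entry is the integral
over `Ω` of `μ (uₙ - u) y_k y_l` against the `(i,j)` entry of `Λ`. -/
def residualMatrix {n d : ℕ} (Ω : Set (E d)) (μ u : E d → ℝ) (c₀ : ℝ) (c : Fin n → ℝ)
    (r : Params n d) : Matrix (Fin n × Fin (d + 1)) (Fin n × Fin (d + 1)) ℝ :=
  Matrix.of fun a b => ∫ x in Ω, μ x * (network c₀ c r x - u x) *
    Matrix.vecMulVec (homog x) (homog x) a.2 b.2 ∂(deltaMatrix r a.1 b.1)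

/-- All integrals in the definition of the residual matrix converge absolutely. -/
def ResidualIntegrable {n d : ℕ} (Ω : Set (E d)) (μ u : E d → ℝ) (c₀ : ℝ) (c : Fin n → ℝ)
    (r : Params n d) : Prop :=
  ∀ a b : Fin n × Fin (d + 1),
    IntegrableOn (fun x => μ x * (network c₀ c r x - u x) *
      Matrix.vecMulVec (homog x) (homog x) a.2 b.2) Ω (deltaMatrix r a.1 b.1)

/-- The gradient of a function on `ℝ^ι`. -/
def grad {ι : Type*} [Fintype ι] [DecidableEq ι] (F : (ι → ℝ) → ℝ) (r : ι → ℝ) : ι → ℝ :=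
  fun a => fderiv ℝ F r (Pi.single a 1)

/-- The Hessian matrix `∇(∇F)ᵀ` of a function on `ℝ^ι`: the `(a,b)` entry is `∂_a ∂_b F`. -/
def hessian {ι : Type*} [Fintype ι] [DecidableEq ι] (F : (ι → ℝ) → ℝ) (r : ι → ℝ) :
    Matrix ι ι ℝ :=
  Matrix.of fun a b => fderiv ℝ (fderiv ℝ F) r (Pi.single a 1) (Pi.single b 1)

/-- The matrix-valued function `M` is the Hessian of `F` on `ℝ^ι` in the weak sense. -/
structure IsWeakHessian {ι : Type*} [Fintype ι] [DecidableEq ι]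
    (F : (ι → ℝ) → ℝ) (M : (ι → ℝ) → Matrix ι ι ℝ) : Prop where
  locallyIntegrable : LocallyIntegrable F
  locallyIntegrable_entry : ∀ a b, LocallyIntegrable (fun r => M r a b)
  integral_eq : ∀ φ : (ι → ℝ) → ℝ, ContDiff ℝ ∞ φ → HasCompactSupport φ →
    ∀ a b, ∫ r, F r * hessian φ r a b = ∫ r, M r a b * φ r

/-- The Gauss-Newton matrix with respect to `r`: `∫_Ω μ (∇_r uₙ) (∇_r uₙ)ᵀ dx`. -/
def gaussNewton {n d : ℕ} (Ω : Set (E d)) (μ : E d → ℝ) (c₀ : ℝ) (c : Fin n → ℝ)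
    (r : Params n d) : Matrix (Fin n × Fin (d + 1)) (Fin n × Fin (d + 1)) ℝ :=
  Matrix.of fun a b => ∫ x in Ω, μ x *
    Matrix.vecMulVec (grad (fun s : Params n d => network c₀ c s x) r)
      (grad (fun s : Params n d => network c₀ c s x) r) a b

end SgGN

end

/-! For fixed `x` each pre-activation `rᵢ · y` is a linear functional `ℓᵢ` of `r` whose derivative
in the bias `bᵢ` is 1. Hence `uₙ` is Lipschitz in `r`, with derivative `cᵢ H(ℓᵢ) y_k` in the
direction `(i, k)` wherever no `ℓᵢ` vanishes. If all `ωᵢ ≠ 0`, the exceptional `x` form a null set,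
and the factorization follows by pulling out the constants `cᵢ`.

Weak Hessian. Put `v = uₙ - u`, `a = (i, k)`. For fixed `x`, one integration by parts turns `½ v²`
against `∂_a ∂_b φ` into `-cᵢ y_k ∫ H(ℓᵢ) v ∂_b φ`. A second one, over the half-space `ℓᵢ > 0` and
applied to the Lipschitz function `v φ`, yields the Gauss-Newton product and a boundary term on `ℓᵢ
= 0` that survives only if `a` and `b` belong to the same neuron
(`integral_heaviside_mul_lineDeriv`, `integral_sq_network_mul_hessian`). Integrated against `μ dx`,
the boundary term runs over `r` for fixed `x`, while the residual matrix runs over `x` for fixed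
`r`. Both are disintegrations of one measure on the incidence set `rᵢ · y = 0`
(`map_graph_eq_map_slide`): all else fixed, the height at which the breaking hyperplane meets a line
in direction `x_k` is affine in `bᵢ` with slope `-1/ω_{ik}`, and `1/|ω_{ik}|` is also the density of
`δᵢ` over the plane `x_k = 0`. The same identity gives absolute convergence for almost every `r` and
local integrability.

Classical Hessian. Dominated differentiation gives `∇J`. For the second derivative at `r`, split
`v_s H_s = (v_s - v_r) H_s + v_r H_s`. The first summand vanishes at `s = r`, is Lipschitz there,
and contributes the Gauss-Newton matrix. The second integrates a fixed function over a moving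
half-space; on each line transversal to the hyperplane this is the fundamental theorem of calculus,
which only needs continuity at the point of intersection (`hasFDerivAt_integral_heaviside`). -/

noncomputable section

namespace SgGN

/-! ### Breaking hyperplanes as graphs over a coordinate plane -/

section Basic

variable {n d m : ℕ}

@[simp] theorem homog_zero (x : E d) : homog x 0 = 1 := rfl

@[simp] theorem homog_succ (x : E d) (k : Fin d) : homog x k.succ = x k := rfl

theorem continuous_homog (k : Fin (d + 1)) : Continuous fun x : E d => homog x k := by
  refine Fin.cases ?_ (fun j => ?_) k
  · simpa using continuous_const
  · simp only [homog_succ]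
    fun_prop

theorem preact_eq (r : Params n d) (i : Fin n) (x : E d) :
    preact r i x = r (i, 0) + ∑ k : Fin d, r (i, k.succ) * x k := by
  simp [preact, Fin.sum_univ_succ]

theorem continuous_preact (i : Fin n) :
    Continuous fun p : Params n d × E d => preact p.1 i p.2 := by
  unfold preact
  refine continuous_finsetSum _ fun k _ => ?_
  exact ((continuous_apply _).comp continuous_fst).mul ((continuous_homog k).comp continuous_snd)

theorem exists_weight_coord_ne_zero {r : Params n d} {i : Fin n} (h : weight r i ≠ 0) :
    ∃ k : Fin d, r (i, k.succ) ≠ 0 := by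
  by_contra! h'
  exact h (by ext k; simpa [weight] using h' k)

/-- The pre-activation `rᵢ · y` as a linear functional of the parameters. -/
def preactL (i : Fin n) (x : E d) : Params n d →L[ℝ] ℝ :=
  ∑ k, homog x k • ContinuousLinearMap.proj (i, k)

theorem preactL_apply (i : Fin n) (x : E d) (r : Params n d) : preactL i x r = preact r i x := by
  simp [preactL, preact, mul_comm]

theorem preactL_single (i : Fin n) (x : E d) (a : Fin n × Fin (d + 1)) :
    preactL i x (Pi.single a 1) = if a.1 = i then homog x a.2 else 0 := by
  obtain ⟨j, l⟩ := a
  rw [preactL_apply, preact]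
  by_cases h : j = i
  · subst h
    simp [Pi.single_apply]
  · simp [h, Ne.symm h, eq_comm]

theorem measurableEquiv_toLp_preserving (ι : Type*) [Fintype ι] :
    MeasurePreserving (MeasurableEquiv.toLp 2 (ι → ℝ)) :=
  (EuclideanSpace.volume_preserving_symm_measurableEquiv_toLp ι).symm

/-- Insertion of the coordinate `x_k = t` into a point of `ℝᵐ`. -/
def ins (k : Fin (m + 1)) : ℝ × (Fin m → ℝ) ≃ᵐ E (m + 1) :=
  (MeasurableEquiv.piFinSuccAbove (fun _ => ℝ) k).symm.trans
    (MeasurableEquiv.toLp 2 (Fin (m + 1) → ℝ))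

theorem measurePreserving_ins (k : Fin (m + 1)) : MeasurePreserving (ins k) :=
  (volume_preserving_piFinSuccAbove (fun _ : Fin (m + 1) => ℝ) k).symm.trans
    (measurableEquiv_toLp_preserving _)

@[simp] theorem ins_same (k : Fin (m + 1)) (t : ℝ) (z : Fin m → ℝ) : ins k (t, z) k = t :=
  Fin.insertNth_apply_same (α := fun _ => ℝ) k t z

@[simp] theorem ins_succAbove (k : Fin (m + 1)) (t : ℝ) (z : Fin m → ℝ) (j : Fin m) :
    ins k (t, z) (k.succAbove j) = z j :=
  Fin.insertNth_apply_succAbove (α := fun _ => ℝ) k t z j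

theorem ins_surj (k : Fin (m + 1)) (x : E (m + 1)) : ins k (x k, fun j => x (k.succAbove j)) = x := by
  ext l
  refine Fin.succAboveCases k ?_ (fun j => ?_) l
  · simp
  · simp

theorem continuous_ins (k : Fin (m + 1)) : Continuous (ins (m := m) k) := by
  have : (ins (m := m) k : ℝ × (Fin m → ℝ) → E (m + 1)) =
      fun p => WithLp.toLp 2 (fun l => ins k p l) := rfl
  rw [this]
  refine (PiLp.continuous_toLp 2 _).comp (continuous_pi fun l => ?_)
  refine Fin.succAboveCases k ?_ (fun j => ?_) l
  · have : (fun p : ℝ × (Fin m → ℝ) => ins k p k) = Prod.fst :=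
      funext fun p => ins_same k p.1 p.2
    rw [this]
    fun_prop
  · have : (fun p : ℝ × (Fin m → ℝ) => ins k p (k.succAbove j)) = fun p => p.2 j :=
      funext fun p => ins_succAbove k p.1 p.2 j
    rw [this]
    fun_prop

/-- The height at which the breaking hyperplane meets the line `{ins k (t, z) | t}`. -/
def height (k : Fin (m + 1)) (r : Params n (m + 1)) (i : Fin n) (z : Fin m → ℝ) : ℝ :=
  -(r (i, 0) + ∑ j, r (i, (k.succAbove j).succ) * z j) / r (i, k.succ)

theorem preact_ins (k : Fin (m + 1)) (r : Params n (m + 1)) (i : Fin n) (t : ℝ) (z : Fin m → ℝ) :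
    preact r i (ins k (t, z)) =
      r (i, 0) + (r (i, k.succ) * t + ∑ j, r (i, (k.succAbove j).succ) * z j) := by
  rw [preact_eq, Fin.sum_univ_succAbove _ k]
  simp

theorem preact_ins_height {k : Fin (m + 1)} {r : Params n (m + 1)} {i : Fin n}
    (hk : r (i, k.succ) ≠ 0) (t : ℝ) (z : Fin m → ℝ) :
    preact r i (ins k (t, z)) = r (i, k.succ) * (t - height k r i z) := by
  rw [preact_ins, height]
  field_simp
  ring

theorem continuous_height (k : Fin (m + 1)) (r : Params n (m + 1)) (i : Fin n) :
    Continuous (height k r i) := by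
  unfold height
  fun_prop

theorem measurable_height (k : Fin (m + 1)) (i : Fin n) :
    Measurable fun p : Params n (m + 1) × (Fin m → ℝ) => height k p.1 i p.2 := by
  unfold height
  fun_prop

/-- The parametrization of the breaking hyperplane over the coordinate plane `x_k = 0`. -/
def graphPt (k : Fin (m + 1)) (r : Params n (m + 1)) (i : Fin n) (z : Fin m → ℝ) :
    E (m + 1) :=
  ins k (height k r i z, z)

theorem continuous_graphPt (k : Fin (m + 1)) (r : Params n (m + 1)) (i : Fin n) :
    Continuous (graphPt k r i) :=
  (continuous_ins k).comp ((continuous_height k r i).prodMk continuous_id)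

theorem measurable_graphPt (k : Fin (m + 1)) (i : Fin n) :
    Measurable fun p : Params n (m + 1) × (Fin m → ℝ) => graphPt k p.1 i p.2 :=
  (ins k).measurable.comp ((measurable_height k i).prodMk measurable_snd)

theorem range_graphPt {k : Fin (m + 1)} {r : Params n (m + 1)} {i : Fin n}
    (hk : r (i, k.succ) ≠ 0) : Set.range (graphPt k r i) = breakingHyperplane r i := by
  ext x
  constructor
  · rintro ⟨z, rfl⟩
    simp [breakingHyperplane, graphPt, preact_ins_height hk]
  · intro hx
    rw [breakingHyperplane, Set.mem_ofPred_eq, ← ins_surj k x, preact_ins_height hk,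
      mul_eq_zero, or_iff_right hk, sub_eq_zero] at hx
    exact ⟨fun j => x (k.succAbove j), by rw [graphPt, ← hx, ins_surj]⟩

/-- Fubini: every line in a direction `k` with nonzero weight meets the hyperplane in the single
point at `height`. -/
theorem volume_breakingHyperplane {r : Params n (m + 1)} {i : Fin n} (h : weight r i ≠ 0) :
    volume (breakingHyperplane r i) = 0 := by
  obtain ⟨k, hk⟩ := exists_weight_coord_ne_zero h
  have hm : MeasurableSet (breakingHyperplane r i) :=
    (isClosed_singleton.preimage ((continuous_preact i).comp
      (Continuous.prodMk_right r)) : IsClosed ((fun x => preact r i x) ⁻¹' {0})).measurableSet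
  rw [← (measurePreserving_ins k).measure_preimage hm.nullMeasurableSet,
    Measure.volume_eq_prod, Measure.prod_apply_symm ((ins k).measurable hm)]
  refine lintegral_eq_zero_of_ae_eq_zero (.of_forall fun z => ?_)
  refine measure_mono_null (t := {height k r i z}) (fun t ht => ?_) (by simp)
  simpa [breakingHyperplane, preact_ins_height hk, hk, sub_eq_zero] using ht

theorem ae_preact_ne_zero {r : Params n d} (h : ∀ i, weight r i ≠ 0) :
    ∀ᵐ x : E d, ∀ i, preact r i x ≠ 0 := by
  cases d with
  -- In dimension zero every weight vector is zero, so a neuron `i` would contradict `h`.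
  | zero => exact .of_forall fun x i => absurd (Subsingleton.elim _ _) (h i)
  | succ m =>
    exact ae_all_iff.2 fun i => measure_eq_zero_iff_ae_notMem.1 (volume_breakingHyperplane (h i))

/-- The linear part of `graphPt`. -/
def graphLin (k : Fin (m + 1)) (r : Params n (m + 1)) (i : Fin n) :
    E m →ₗ[ℝ] E (m + 1) where
  toFun z := ins k (-(∑ j, r (i, (k.succAbove j).succ) * z j) / r (i, k.succ), z)
  map_add' z w := by
    ext l
    refine Fin.succAboveCases k ?_ (fun j => ?_) l
    · simp [mul_add, Finset.sum_add_distrib]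
      ring
    · simp
  map_smul' c z := by
    ext l
    refine Fin.succAboveCases k ?_ (fun j => ?_) l
    · simp only [PiLp.smul_apply, smul_eq_mul, ins_same, RingHom.id_apply, WithLp.ofLp_smul,
        mul_left_comm _ c, ← Finset.mul_sum]
      ring
    · simp

/-- The Gram matrix of the graph map is `1 + a aᵀ`, where `a` is the vector of the remaining weights
divided by the `k`-th one. The rank-one determinant formula gives `1 + |a|² = |ωᵢ|² / ω_{ik}²`. -/
theorem normDet_graphLin {k : Fin (m + 1)} {r : Params n (m + 1)} {i : Fin n}
    (hk : r (i, k.succ) ≠ 0) :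
    (graphLin k r i).normDet = ‖weight r i‖ * |r (i, k.succ)|⁻¹ := by
  set a : Fin m → ℝ := fun j => r (i, (k.succAbove j).succ) / r (i, k.succ) with ha
  have hcol : ∀ j, graphLin k r i (EuclideanSpace.basisFun (Fin m) ℝ j) =
      ins k (-a j, Pi.single j 1) := by
    intro j
    simp [graphLin, ha, neg_div]
  have hgram : Matrix.gram ℝ (fun j => graphLin k r i (EuclideanSpace.basisFun (Fin m) ℝ j)) =
      1 + Matrix.replicateCol Unit a * Matrix.replicateRow Unit a := by
    ext p q
    simp only [Matrix.gram_apply, hcol, PiLp.inner_apply, Fin.sum_univ_succAbove _ k, ins_same,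
      ins_succAbove]
    simp [Matrix.one_apply, Matrix.mul_apply, Pi.single_apply, mul_comm, add_comm, eq_comm]
  have h1 := (graphLin k r i).normDet_sq_eq_det_gram (EuclideanSpace.basisFun (Fin m) ℝ)
  rw [hgram, Matrix.det_one_add_replicateCol_mul_replicateRow] at h1
  have h2 : (‖weight r i‖ * |r (i, k.succ)|⁻¹) ^ 2 = 1 + a ⬝ᵥ a := by
    rw [mul_pow, EuclideanSpace.norm_sq_eq, Fin.sum_univ_succAbove _ k, inv_pow, sq_abs]
    simp only [weight, Real.norm_eq_abs, sq_abs, dotProduct, ha]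
    rw [add_mul, mul_inv_cancel₀ (pow_ne_zero 2 hk), Finset.sum_mul]
    congr 1
    refine Finset.sum_congr rfl fun j _ => ?_
    field_simp
  exact (sq_eq_sq₀ (graphLin k r i).normDet_nonneg (by positivity)).1 (by rw [h2]; simpa using h1)

/-- The delta measure on a breaking hyperplane in terms of its graph parametrization. -/
theorem breakingDelta_eq_map {k : Fin (m + 1)} {r : Params n (m + 1)} {i : Fin n}
    (hk : r (i, k.succ) ≠ 0) :
    breakingDelta r i = ENNReal.ofReal |r (i, k.succ)|⁻¹ • Measure.map (graphPt k r i) volume := by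
  have hw : weight r i ≠ 0 := fun h => hk (by simpa [weight] using congrArg (fun v => v k) h)
  have hnorm : 0 < ‖weight r i‖ := norm_pos_iff.2 hw
  ext A hA
  have hpre : MeasurableSet (graphPt k r i ⁻¹' A) := (continuous_graphPt k r i).measurable hA
  -- The graph is a translate of a linear image, so its Hausdorff measure is `normDet` times
  -- Lebesgue measure; the factor `‖ωᵢ‖` then cancels against the normalization of `breakingDelta`.
  have himg : A ∩ breakingHyperplane r i =
      (fun x => ins k (-r (i, 0) / r (i, k.succ), 0) + x) ''
        (graphLin k r i '' (WithLp.toLp 2 '' (graphPt k r i ⁻¹' A))) := by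
    rw [Set.image_image, Set.image_image, ← range_graphPt hk, ← Set.image_preimage_eq_inter_range]
    refine Set.image_congr fun z _ => ?_
    ext l
    refine Fin.succAboveCases k ?_ (fun j => ?_) l
    · simp [graphPt, graphLin, height]
      ring
    · simp [graphPt, graphLin]
  have hvol : volume (WithLp.toLp 2 '' (graphPt k r i ⁻¹' A)) = volume (graphPt k r i ⁻¹' A) := by
    have := (measurableEquiv_toLp_preserving (Fin m)).symm.measure_preimage hpre.nullMeasurableSet
    rw [← this]
    congr 1
    exact (MeasurableEquiv.toLp 2 (Fin m → ℝ)).image_eq_preimage_symm _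
  have hH : Measure.euclideanHausdorffMeasure m (A ∩ breakingHyperplane r i) =
      ENNReal.ofReal (‖weight r i‖ * |r (i, k.succ)|⁻¹) * volume (graphPt k r i ⁻¹' A) := by
    rw [himg, (isometry_add_left _).euclideanHausdorffMeasure_image, ← normDet_graphLin hk, ← hvol,
      ← LinearMap.euclideanHausdorffMeasure_image_eq_normDet_mul_volume, finrank_euclideanSpace_fin]
  rw [breakingDelta, Measure.smul_apply, Measure.smul_apply, Measure.restrict_apply hA,
    Measure.map_apply (continuous_graphPt k r i).measurable hA, Nat.add_sub_cancel, hH,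
    smul_eq_mul, smul_eq_mul, ← mul_assoc, ← ENNReal.ofReal_mul (by positivity)]
  congr 2
  field_simp

end Basic

/-! ### Derivative of the network in its parameters, and the matrix entries -/

section Network

variable {n d : ℕ}

theorem relu_lipschitz (s t : ℝ) : |relu s - relu t| ≤ |s - t| := by
  unfold relu
  simpa using abs_max_sub_max_le_abs s t 0 |>.trans_eq' (by rw [max_comm 0 s, max_comm 0 t])

theorem continuous_relu : Continuous relu := by
  unfold relu
  fun_prop

theorem hasDerivAt_relu {t : ℝ} (ht : t ≠ 0) : HasDerivAt relu (heaviside t) t := by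
  rcases lt_or_gt_of_ne ht with h | h
  · have : relu =ᶠ[𝓝 t] fun _ => 0 := by
      filter_upwards [eventually_lt_nhds h] with s hs
      exact max_eq_left hs.le
    rw [heaviside, if_neg h.not_gt]
    exact (hasDerivAt_const t 0).congr_of_eventuallyEq this
  · have : relu =ᶠ[𝓝 t] id := by
      filter_upwards [eventually_gt_nhds h] with s hs
      exact max_eq_right (le_of_lt hs)
    rw [heaviside, if_pos h]
    exact (hasDerivAt_id t).congr_of_eventuallyEq this

theorem heaviside_nonneg (t : ℝ) : 0 ≤ heaviside t := by
  unfold heaviside; split_ifs <;> norm_num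

theorem heaviside_le_one (t : ℝ) : heaviside t ≤ 1 := by
  unfold heaviside; split_ifs <;> norm_num

theorem abs_heaviside_le_one (t : ℝ) : |heaviside t| ≤ 1 := by
  rw [abs_of_nonneg (heaviside_nonneg t)]
  exact heaviside_le_one t

theorem measurable_heaviside : Measurable heaviside :=
  Measurable.ite measurableSet_Ioi measurable_const measurable_const

theorem heaviside_eventuallyEq {t : ℝ} (ht : t ≠ 0) : heaviside =ᶠ[𝓝 t] fun _ => heaviside t := by
  rcases lt_or_gt_of_ne ht with h | h
  · filter_upwards [eventually_lt_nhds h] with s hs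
    simp [heaviside, hs.not_gt, h.not_gt]
  · filter_upwards [eventually_gt_nhds h] with s hs
    have hs : 0 < s := hs
    simp [heaviside, hs, h]

theorem continuous_network (c₀ : ℝ) (c : Fin n → ℝ) :
    Continuous fun p : Params n d × E d => network c₀ c p.1 p.2 := by
  unfold network
  exact continuous_const.add (continuous_finsetSum _ fun i _ =>
    continuous_const.mul (continuous_relu.comp (continuous_preact i)))

/-- The differential of the network with respect to its parameters. -/
def networkD (c : Fin n → ℝ) (r : Params n d) (x : E d) : Params n d →L[ℝ] ℝ :=
  ∑ i, (c i * heaviside (preact r i x)) • preactL i x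

theorem networkD_single (c : Fin n → ℝ) (r : Params n d) (x : E d) (a : Fin n × Fin (d + 1)) :
    networkD c r x (Pi.single a 1) = c a.1 * heaviside (preact r a.1 x) * homog x a.2 := by
  simp [networkD, preactL_single]

theorem hasFDerivAt_network (c₀ : ℝ) (c : Fin n → ℝ) {r : Params n d} {x : E d}
    (h : ∀ i, preact r i x ≠ 0) :
    HasFDerivAt (fun s : Params n d => network c₀ c s x) (networkD c r x) r := by
  unfold network networkD
  refine (HasFDerivAt.fun_sum fun i _ => ?_).const_add c₀
  have h1 : HasFDerivAt (fun s : Params n d => preact s i x) (preactL i x) r := by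
    exact (preactL i x).hasFDerivAt.congr_of_eventuallyEq
      (.of_forall fun s => (preactL_apply i x s).symm)
  have h2 := ((hasDerivAt_relu (h i)).comp_hasFDerivAt r h1).const_mul (c i)
  rwa [smul_smul] at h2

theorem grad_network (c₀ : ℝ) (c : Fin n → ℝ) {r : Params n d} {x : E d}
    (h : ∀ i, preact r i x ≠ 0) (a : Fin n × Fin (d + 1)) :
    grad (fun s : Params n d => network c₀ c s x) r a =
      c a.1 * heaviside (preact r a.1 x) * homog x a.2 := by
  rw [grad, (hasFDerivAt_network c₀ c h).fderiv, networkD_single]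

theorem scaling_eq_diagonal (d : ℕ) (c : Fin n → ℝ) :
    scaling d c = Matrix.diagonal fun a => c a.1 := by
  rw [scaling, ← Matrix.diagonal_one, Matrix.diagonal_kronecker_diagonal]
  simp

theorem layerGN_apply (Ω : Set (E d)) (μ : E d → ℝ) (r : Params n d) (a b : Fin n × Fin (d + 1)) :
    layerGN Ω μ r a b = ∫ x in Ω, μ x * (heaviside (preact r a.1 x) * heaviside (preact r b.1 x) *
      (homog x a.2 * homog x b.2)) := by
  simp [layerGN, Matrix.kroneckerMap_apply, Matrix.vecMulVec_apply, heavisideVec]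

theorem gaussNewton_apply (Ω : Set (E d)) (μ : E d → ℝ) (c₀ : ℝ) (c : Fin n → ℝ) {r : Params n d}
    (h : ∀ i, weight r i ≠ 0) (a b : Fin n × Fin (d + 1)) :
    gaussNewton Ω μ c₀ c r a b = c a.1 * c b.1 * layerGN Ω μ r a b := by
  rw [layerGN_apply, ← integral_const_mul]
  refine integral_congr_ae (ae_restrict_of_ae ?_)
  filter_upwards [ae_preact_ne_zero h] with x hx
  simp only [Matrix.vecMulVec_apply, grad_network c₀ c hx]
  ring

/-- `D(c) ⊗ I` is diagonal with entry `cᵢ` at `(i, k)`, so the sandwich multiplies each entry by the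
two outer weights found in `gaussNewton_apply`. -/
theorem gaussNewton_factorization (Ω : Set (E d)) (μ : E d → ℝ) (c₀ : ℝ) (c : Fin n → ℝ)
    {r : Params n d} (h : ∀ i, weight r i ≠ 0) :
    gaussNewton Ω μ c₀ c r = scaling d c * layerGN Ω μ r * scaling d c := by
  ext a b
  rw [gaussNewton_apply Ω μ c₀ c h, scaling_eq_diagonal, Matrix.mul_diagonal,
    Matrix.diagonal_mul]
  ring

theorem residualMatrix_apply (Ω : Set (E d)) (μ u : E d → ℝ) (c₀ : ℝ) (c : Fin n → ℝ)
    (r : Params n d) (a b : Fin n × Fin (d + 1)) :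
    residualMatrix Ω μ u c₀ c r a b = if a.1 = b.1 then
      ∫ x in Ω, μ x * (network c₀ c r x - u x) * (homog x a.2 * homog x b.2) ∂(breakingDelta r a.1)
      else 0 := by
  simp only [residualMatrix, Matrix.of_apply, deltaMatrix, Matrix.diagonal_apply,
    Matrix.vecMulVec_apply]
  by_cases h : a.1 = b.1
  · rw [if_pos h, if_pos h]
  · rw [if_neg h, if_neg h, Measure.restrict_zero, integral_zero_measure]

theorem residualIntegrable_iff (Ω : Set (E d)) (μ u : E d → ℝ) (c₀ : ℝ) (c : Fin n → ℝ)
    (r : Params n d) : ResidualIntegrable Ω μ u c₀ c r ↔ ∀ i k l,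
      IntegrableOn (fun x => μ x * (network c₀ c r x - u x) * (homog x k * homog x l)) Ω
        (breakingDelta r i) := by
  simp only [ResidualIntegrable, deltaMatrix, Matrix.diagonal_apply, Matrix.vecMulVec_apply]
  constructor
  · intro h i k l
    simpa using h (i, k) (i, l)
  · intro h a b
    split_ifs
    · exact h _ _ _
    · rw [IntegrableOn, Measure.restrict_zero]
      exact integrable_zero_measure

theorem hessianMatrix_apply (Ω : Set (E d)) (μ u : E d → ℝ) (c₀ : ℝ) (c : Fin n → ℝ)
    {r : Params n d} (h : ∀ i, weight r i ≠ 0) (a b : Fin n × Fin (d + 1)) :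
    (gaussNewton Ω μ c₀ c r + residualMatrix Ω μ u c₀ c r * scaling d c) a b =
      c a.1 * c b.1 * layerGN Ω μ r a b + residualMatrix Ω μ u c₀ c r a b * c b.1 := by
  rw [Matrix.add_apply, gaussNewton_apply Ω μ c₀ c h, scaling_eq_diagonal, Matrix.mul_diagonal]

/-- Source of the domination constants below: since `relu` is 1-Lipschitz and `y` is bounded on `Ω`,
the Lipschitz constant and the linear growth in `r` are uniform in `x`. -/
theorem exists_network_bound {Ω : Set (E d)} (hΩ : Bornology.IsBounded Ω) (c₀ : ℝ) (c : Fin n → ℝ) :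
    ∃ C : ℝ, 1 ≤ C ∧ ∀ x ∈ Ω, (∀ k, |homog x k| ≤ C) ∧
      (∀ r s : Params n d, |network c₀ c r x - network c₀ c s x| ≤ C * ‖r - s‖) ∧
      (∀ r : Params n d, |network c₀ c r x| ≤ C * (1 + ‖r‖)) := by
  obtain ⟨R, hR⟩ := hΩ.exists_norm_le
  set B := max 1 R
  have hB1 : 1 ≤ B := le_max_left _ _
  set S := ∑ i, |c i| * ((d + 1) * B) with hS
  have hS0 : 0 ≤ S := Finset.sum_nonneg fun i _ => by positivity
  have hh : ∀ x ∈ Ω, ∀ k, |homog x k| ≤ B := by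
    intro x hx k
    refine Fin.cases ?_ (fun j => ?_) k
    · simpa using hB1
    · exact (PiLp.norm_apply_le x j).trans ((hR x hx).trans (le_max_right _ _))
  have hp : ∀ x ∈ Ω, ∀ i, ∀ r s : Params n d,
      |preact r i x - preact s i x| ≤ (d + 1) * B * ‖r - s‖ := by
    intro x hx i r s
    rw [preact, preact, ← Finset.sum_sub_distrib]
    refine (Finset.abs_sum_le_sum_abs _ _).trans ?_
    have : ∀ k ∈ Finset.univ, |r (i, k) * homog x k - s (i, k) * homog x k| ≤ ‖r - s‖ * B := by
      intro k _
      rw [← sub_mul, abs_mul]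
      exact mul_le_mul (norm_le_pi_norm (r - s) (i, k)) (hh x hx k) (abs_nonneg _) (norm_nonneg _)
    refine (Finset.sum_le_sum this).trans_eq ?_
    simp
    ring
  have hn : ∀ x ∈ Ω, ∀ r s : Params n d,
      |network c₀ c r x - network c₀ c s x| ≤ S * ‖r - s‖ := by
    intro x hx r s
    rw [network, network, add_sub_add_left_eq_sub, ← Finset.sum_sub_distrib, hS, Finset.sum_mul]
    refine (Finset.abs_sum_le_sum_abs _ _).trans (Finset.sum_le_sum fun i _ => ?_)
    rw [← mul_sub, abs_mul, mul_assoc]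
    exact mul_le_mul_of_nonneg_left ((relu_lipschitz _ _).trans (hp x hx i r s)) (abs_nonneg _)
  refine ⟨B + S + |c₀|, by linarith [abs_nonneg c₀], fun x hx => ⟨fun k => ?_, fun r s => ?_,
    fun r => ?_⟩⟩
  · linarith [hh x hx k, abs_nonneg c₀]
  · refine (hn x hx r s).trans (mul_le_mul_of_nonneg_right ?_ (norm_nonneg _))
    linarith [abs_nonneg c₀]
  -- Growth is the Lipschitz estimate compared with `r = 0`, where the network equals `c₀`.
  · have h0 : network c₀ c (0 : Params n d) x = c₀ := by simp [network, preact, relu]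
    have h1 := hn x hx r 0
    rw [h0, sub_zero] at h1
    have h2 : |network c₀ c r x| ≤ |network c₀ c r x - c₀| + |c₀| := by
      simpa using abs_add_le (network c₀ c r x - c₀) c₀
    nlinarith [abs_nonneg c₀, norm_nonneg r]

end Network

/-! ### First derivative of the loss -/

section Loss

variable {n d : ℕ} {Ω : Set (E d)} {μ u : E d → ℝ}

/-- Because `(1 + |u|)² ≤ 2 + 2u²`. On `Ω` the residual is at most a multiple of `1 + |u|`, locally
uniformly in `r`, so this majorant controls terms both linear and quadratic in the residual. -/
theorem integrableOn_dominating (hΩ : MeasurableSet Ω) (hμ_nonneg : ∀ x ∈ Ω, 0 ≤ μ x)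
    (hμ : IntegrableOn μ Ω) (hu : AEStronglyMeasurable u (volume.restrict Ω))
    (hu_sq : IntegrableOn (fun x => μ x * u x ^ 2) Ω) :
    IntegrableOn (fun x => μ x * (1 + |u x|) ^ 2) Ω := by
  refine Integrable.mono' ((hμ.const_mul 2).add (hu_sq.const_mul 2)) ?_ ?_
  · exact hμ.aestronglyMeasurable.mul ((aestronglyMeasurable_const.add hu.norm).pow 2)
  · filter_upwards [ae_restrict_mem hΩ] with x hx
    have h := hμ_nonneg x hx
    rw [Real.norm_of_nonneg (by positivity)]
    simp only [Pi.add_apply]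
    nlinarith [mul_nonneg h (sq_nonneg (1 - |u x|)), sq_abs (u x)]

theorem loss_eq (hΩ : MeasurableSet Ω) (hμ_nonneg : ∀ x ∈ Ω, 0 ≤ μ x) (c₀ : ℝ) (c : Fin n → ℝ)
    (r : Params n d) :
    loss Ω μ u c₀ c r = ∫ x in Ω, μ x * (1 / 2 * (network c₀ c r x - u x) ^ 2) := by
  rw [loss, lsFunctional, weightedNorm, Real.sq_sqrt, ← integral_const_mul]
  · congr 1 with x
    ring
  · exact setIntegral_nonneg hΩ fun x hx => mul_nonneg (hμ_nonneg x hx) (sq_nonneg _)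

/-- The partial derivatives of the loss. -/
def lossGrad (Ω : Set (E d)) (μ u : E d → ℝ) (c₀ : ℝ) (c : Fin n → ℝ)
    (r : Params n d) (b : Fin n × Fin (d + 1)) : ℝ :=
  ∫ x in Ω, μ x * (network c₀ c r x - u x) * (c b.1 * heaviside (preact r b.1 x) * homog x b.2)

theorem continuous_network_right (c₀ : ℝ) (c : Fin n → ℝ) (r : Params n d) :
    Continuous fun x : E d => network c₀ c r x :=
  (continuous_network c₀ c).comp (Continuous.prodMk_right r)

theorem continuous_preact_right (r : Params n d) (i : Fin n) :
    Continuous fun x : E d => preact r i x :=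
  (continuous_preact i).comp (Continuous.prodMk_right r)

theorem aestronglyMeasurable_resid (hu : AEStronglyMeasurable u (volume.restrict Ω)) (c₀ : ℝ)
    (c : Fin n → ℝ) (r : Params n d) :
    AEStronglyMeasurable (fun x => network c₀ c r x - u x) (volume.restrict Ω) :=
  (continuous_network_right c₀ c r).aestronglyMeasurable.sub hu

theorem clm_pi_eq_sum {ι : Type*} [Fintype ι] [DecidableEq ι] (L : (ι → ℝ) →L[ℝ] ℝ) :
    L = ∑ b, L (Pi.single b 1) • ContinuousLinearMap.proj (R := ℝ) (φ := fun _ : ι => ℝ) b := by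
  ext h
  have := LinearMap.pi_apply_eq_sum_univ (L : (ι → ℝ) →ₗ[ℝ] ℝ) h
  simp only [ContinuousLinearMap.coe_coe, smul_eq_mul] at this
  simp only [sum_apply, smul_apply, ContinuousLinearMap.proj_apply,
    smul_eq_mul, this]
  refine Finset.sum_congr rfl fun b _ => ?_
  rw [mul_comm]
  congr 2
  ext j
  simp [Pi.single_apply, eq_comm]

theorem measurable_networkD (c : Fin n → ℝ) (r : Params n d) :
    StronglyMeasurable fun x : E d => networkD c r x := by
  unfold networkD preactL
  refine Finset.stronglyMeasurable_fun_sum _ fun i _ => ?_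
  have h1 : StronglyMeasurable fun x : E d => c i * heaviside (preact r i x) :=
    ((measurable_heaviside.comp (continuous_preact_right r i).measurable).const_mul
      _).stronglyMeasurable
  have h2 : StronglyMeasurable fun x : E d => ∑ k, homog x k •
      ContinuousLinearMap.proj (R := ℝ) (φ := fun _ : Fin n × Fin (d + 1) => ℝ) (i, k) :=
    Finset.stronglyMeasurable_fun_sum _ fun k _ =>
      (continuous_homog k).stronglyMeasurable.smul_const _
  exact h1.smul h2

/-- Differentiation under the integral: the integrand is differentiable at `r` for every `x` off the
breaking hyperplanes, a null set, and a difference of squares factors into a bounded multiple of `1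
+ |u|` times a Lipschitz increment. -/
theorem hasFDerivAt_loss (hΩ_open : IsOpen Ω) (hΩ_bdd : Bornology.IsBounded Ω)
    (hμ_nonneg : ∀ x ∈ Ω, 0 ≤ μ x) (hμ : IntegrableOn μ Ω)
    (hu : AEStronglyMeasurable u (volume.restrict Ω))
    (hu_sq : IntegrableOn (fun x => μ x * u x ^ 2) Ω) (c₀ : ℝ) (c : Fin n → ℝ)
    {r : Params n d} (hr : ∀ i, weight r i ≠ 0) :
    HasFDerivAt (fun s : Params n d => loss Ω μ u c₀ c s)
      (∑ b, lossGrad Ω μ u c₀ c r b •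
        ContinuousLinearMap.proj (R := ℝ) (φ := fun _ : Fin n × Fin (d + 1) => ℝ) b) r := by
  have hΩ := hΩ_open.measurableSet
  have hdom := integrableOn_dominating hΩ hμ_nonneg hμ hu hu_sq
  obtain ⟨C, hC1, hC⟩ := exists_network_bound (n := n) hΩ_bdd c₀ c
  have hmeas : ∀ s : Params n d, AEStronglyMeasurable
      (fun x => μ x * (1 / 2 * (network c₀ c s x - u x) ^ 2)) (volume.restrict Ω) := fun s =>
    hμ.aestronglyMeasurable.mul (((aestronglyMeasurable_resid hu c₀ c s).pow 2).const_mul _)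
  have hv : ∀ x ∈ Ω, ∀ s : Params n d,
      |network c₀ c s x - u x| ≤ C * (1 + ‖s‖) * (1 + |u x|) := by
    intro x hx s
    have h1 := (hC x hx).2.2 s
    have h2 : 1 ≤ C * (1 + ‖s‖) := by nlinarith [norm_nonneg s]
    calc _ ≤ |network c₀ c s x| + |u x| := abs_sub _ _
      _ ≤ _ := by nlinarith [abs_nonneg (u x)]
  have key : Integrable (fun x => (μ x * (network c₀ c r x - u x)) • networkD c r x)
      (volume.restrict Ω) ∧
      HasFDerivAt (fun s : Params n d => ∫ x in Ω, μ x * (1 / 2 * (network c₀ c s x - u x) ^ 2))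
        (∫ x in Ω, (μ x * (network c₀ c r x - u x)) • networkD c r x) r := by
    -- In the bound, one `C` is the Lipschitz constant of the network; `C * (2 + ‖r‖)` is its growth
    -- bound on the unit ball about `r`.
    refine hasFDerivAt_integral_of_dominated_loc_of_lip'
      (bound := fun x => C * (C * (2 + ‖r‖)) * (μ x * (1 + |u x|) ^ 2))
      (Metric.ball_mem_nhds r one_pos) (fun s _ => hmeas s) ?_ ?_ ?_ (hdom.const_mul _) ?_
    · refine Integrable.mono' (hdom.const_mul ((C * (1 + ‖r‖)) ^ 2)) (hmeas r) ?_
      filter_upwards [ae_restrict_mem hΩ] with x hx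
      have h := hμ_nonneg x hx
      have h3 := pow_le_pow_left₀ (abs_nonneg _) (hv x hx r) 2
      rw [sq_abs] at h3
      rw [Real.norm_of_nonneg (by positivity)]
      have := mul_le_mul_of_nonneg_left h3 h
      rw [mul_pow] at this
      nlinarith [mul_nonneg h (sq_nonneg (network c₀ c r x - u x))]
    · exact (hμ.aestronglyMeasurable.mul (aestronglyMeasurable_resid hu c₀ c r)).smul
        (measurable_networkD c r).aestronglyMeasurable
    · filter_upwards [ae_restrict_mem hΩ] with x hx s hs
      have h := hμ_nonneg x hx
      have hs' : ‖s‖ ≤ 1 + ‖r‖ := by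
        rw [Metric.mem_ball, dist_eq_norm] at hs
        linarith [norm_sub_norm_le s r]
      rw [Real.norm_eq_abs, ← mul_sub, ← mul_sub, sq_sub_sq, abs_mul, abs_of_nonneg h, abs_mul,
        abs_mul, abs_of_nonneg (by norm_num : (0 : ℝ) ≤ 1 / 2), sub_sub_sub_cancel_right]
      have h1 := (hC x hx).2.1 s r
      have h2 : |network c₀ c s x - u x + (network c₀ c r x - u x)| ≤
          2 * (C * (2 + ‖r‖) * (1 + |u x|)) := by
        refine (abs_add_le _ _).trans ?_
        have e1 := hv x hx s
        have e2 := hv x hx r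
        have e3 : C * (1 + ‖s‖) * (1 + |u x|) ≤ C * (2 + ‖r‖) * (1 + |u x|) :=
          mul_le_mul_of_nonneg_right (mul_le_mul_of_nonneg_left (by linarith) (by linarith))
            (by positivity)
        have e4 : C * (1 + ‖r‖) * (1 + |u x|) ≤ C * (2 + ‖r‖) * (1 + |u x|) :=
          mul_le_mul_of_nonneg_right (mul_le_mul_of_nonneg_left (by linarith) (by linarith))
            (by positivity)
        linarith
      have h3 : |network c₀ c s x - u x + (network c₀ c r x - u x)| *
          |network c₀ c s x - network c₀ c r x| ≤
          2 * (C * (2 + ‖r‖) * (1 + |u x|)) * (C * ‖s - r‖) :=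
        mul_le_mul h2 h1 (abs_nonneg _) (by positivity)
      have h4 : (1 + |u x|) ≤ (1 + |u x|) ^ 2 := by nlinarith [abs_nonneg (u x)]
      calc _ ≤ μ x * (1 / 2 * (2 * (C * (2 + ‖r‖) * (1 + |u x|)) * (C * ‖s - r‖))) := by gcongr
        _ = C * (C * (2 + ‖r‖)) * (μ x * (1 + |u x|)) * ‖s - r‖ := by ring
        _ ≤ _ := by gcongr
    · refine ae_restrict_of_ae ?_
      filter_upwards [ae_preact_ne_zero hr] with x hx
      have h1 := ((((hasFDerivAt_network c₀ c hx).sub_const (u x)).pow 2).const_mul (1 / 2)).const_mul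
        (μ x)
      refine h1.congr_fderiv ?_
      ext h
      simp
      ring
  obtain ⟨hint, hder⟩ := key
  rw [clm_pi_eq_sum (∫ x in Ω, (μ x * (network c₀ c r x - u x)) • networkD c r x)] at hder
  have hl : (fun s : Params n d => loss Ω μ u c₀ c s) = fun s =>
      ∫ x in Ω, μ x * (1 / 2 * (network c₀ c s x - u x) ^ 2) :=
    funext fun s => loss_eq hΩ hμ_nonneg c₀ c s
  rw [hl]
  have hb : ∀ b, (∫ x in Ω, (μ x * (network c₀ c r x - u x)) • networkD c r x)
      (Pi.single b 1) = lossGrad Ω μ u c₀ c r b := by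
    intro b
    rw [ContinuousLinearMap.integral_apply hint]
    simp only [lossGrad, smul_apply, networkD_single, smul_eq_mul]
  simpa only [hb] using hder

end Loss

/-! ### Integrals over a moving half-space -/

section HalfSpace

variable {n m : ℕ}

/-- Evaluating the pre-activation for `s` at the fixed point `graphPt k r i z` gives `s (i, k.succ)`
times the difference of heights. Solving for the new height leaves a quotient whose numerator
vanishes at `s = r`, so the derivative of the denominator drops out. -/
theorem hasFDerivAt_height {k : Fin (m + 1)} {r : Params n (m + 1)} {i : Fin n}
    (hk : r (i, k.succ) ≠ 0) (z : Fin m → ℝ) :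
    HasFDerivAt (fun s : Params n (m + 1) => height k s i z)
      ((-(r (i, k.succ))⁻¹) • preactL i (graphPt k r i z)) r := by
  have hev : (fun s : Params n (m + 1) => height k s i z) =ᶠ[𝓝 r] fun s =>
      height k r i z - preactL i (graphPt k r i z) s * (s (i, k.succ))⁻¹ := by
    have hc : ContinuousAt (fun s : Params n (m + 1) => s (i, k.succ)) r :=
      (continuous_apply _).continuousAt
    filter_upwards [hc.eventually_ne hk] with s hs
    rw [preactL_apply, graphPt, preact_ins_height hs]
    field_simp
    ring
  have h0 : preactL i (graphPt k r i z) r = 0 := by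
    rw [preactL_apply, graphPt, preact_ins_height hk, sub_self, mul_zero]
  have h1 : HasFDerivAt (fun s : Params n (m + 1) => s (i, k.succ))
      (ContinuousLinearMap.proj (R := ℝ) (φ := fun _ : Fin n × Fin (m + 1 + 1) => ℝ) (i, k.succ)) r :=
    (ContinuousLinearMap.proj (R := ℝ) (φ := fun _ : Fin n × Fin (m + 1 + 1) => ℝ)
      (i, k.succ)).hasFDerivAt
  have h2 := ((hasDerivAt_inv hk).comp_hasFDerivAt r h1)
  have h3 := ((preactL i (graphPt k r i z)).hasFDerivAt (x := r)).mul h2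
  refine ((h3.const_sub (height k r i z)).congr_fderiv ?_).congr_of_eventuallyEq hev
  ext h
  simp [h0]

theorem continuous_preactL (i : Fin n) : Continuous fun x : E m => preactL i x := by
  unfold preactL
  exact continuous_finsetSum _ fun k _ => (continuous_homog k).smul continuous_const

/-- The continuity points form a Gδ set, and the function is continuous on that set. This supplies
measurability with respect to the surface measures, which are singular, so measurability for
`volume` does not provide it. -/
theorem aestronglyMeasurable_of_ae_continuousAt {α : Type*} [TopologicalSpace α]
    [MeasurableSpace α] [OpensMeasurableSpace α] {g : α → ℝ} {ν : Measure α}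
    (h : ∀ᵐ x ∂ν, ContinuousAt g x) : AEStronglyMeasurable g ν := by
  have hm : MeasurableSet {x | ContinuousAt g x} := (IsGδ.setOfPred_continuousAt g).measurableSet
  have hc : ContinuousOn g {x | ContinuousAt g x} := fun x hx =>
    ContinuousAt.continuousWithinAt hx
  have h1 : AEMeasurable g (ν.restrict {x | ContinuousAt g x}) := hc.aemeasurable hm
  have h2 : ν.restrict {x | ContinuousAt g x} = ν := Measure.restrict_eq_self_of_ae_mem h
  rw [h2] at h1
  exact h1.aestronglyMeasurable

/-- Slopes of equal sign make both half-lines point the same way, so they differ by the interval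
between their endpoints. The signed indicators match the convention of oriented interval integrals.
-/
theorem heaviside_mul_sub_sub {p q a b t : ℝ} (hpq : 0 < p * q) (hta : t ≠ a) (htb : t ≠ b) :
    heaviside (q * (t - b)) - heaviside (p * (t - a)) =
      -SignType.sign p * ((Set.Ioc a b).indicator 1 t - (Set.Ioc b a).indicator 1 t) := by
  have hta' := lt_or_gt_of_ne hta
  have htb' := lt_or_gt_of_ne htb
  rcases pos_and_pos_or_neg_and_neg_of_mul_pos hpq with ⟨hp, hq⟩ | ⟨hp, hq⟩
  · have e1 : ∀ c, (0 < q * (t - c)) ↔ c < t := fun c => by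
      rw [mul_pos_iff_of_pos_left hq, sub_pos]
    have e2 : ∀ c, (0 < p * (t - c)) ↔ c < t := fun c => by
      rw [mul_pos_iff_of_pos_left hp, sub_pos]
    simp only [heaviside, e1, e2, sign_pos hp, Set.indicator_apply, Set.mem_Ioc, Pi.one_apply]
    rcases hta' with h1 | h1 <;> rcases htb' with h2 | h2 <;>
      simp [h1, h2, h1.le, h2.le, h1.not_gt, h2.not_gt, h1.not_ge, h2.not_ge]
  · have e1 : ∀ c, (0 < q * (t - c)) ↔ t < c := fun c => by
      rw [mul_pos_iff, sub_neg]
      simp [hq, hq.not_gt]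
    have e2 : ∀ c, (0 < p * (t - c)) ↔ t < c := fun c => by
      rw [mul_pos_iff, sub_neg]
      simp [hp, hp.not_gt]
    simp only [heaviside, e1, e2, sign_neg hp, Set.indicator_apply, Set.mem_Ioc, Pi.one_apply]
    rcases hta' with h1 | h1 <;> rcases htb' with h2 | h2 <;>
      simp [h1, h2, h1.le, h2.le, h1.not_gt, h2.not_gt, h1.not_ge, h2.not_ge]

theorem integral_mul_heaviside_sub {p q a b : ℝ} (hpq : 0 < p * q) (g : ℝ → ℝ) :
    ∫ t, g t * (heaviside (q * (t - b)) - heaviside (p * (t - a))) =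
      -SignType.sign p * ∫ t in a..b, g t := by
  have h1 : ∀ᵐ t : ℝ, g t * (heaviside (q * (t - b)) - heaviside (p * (t - a))) =
      -SignType.sign p * ((Set.Ioc a b).indicator g t - (Set.Ioc b a).indicator g t) := by
    have ha : ∀ c : ℝ, ∀ᵐ t : ℝ, t ≠ c := fun c => by
      simp [ae_iff]
    filter_upwards [ha a, ha b] with t hta htb
    rw [heaviside_mul_sub_sub hpq hta htb, mul_left_comm, mul_sub]
    simp only [Set.indicator_apply, Pi.one_apply, mul_ite, mul_one, mul_zero]
  rw [integral_congr_ae h1, integral_const_mul]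
  congr 1
  rcases le_total a b with h | h
  · simp [Set.Ioc_eq_empty_of_le h, integral_indicator, intervalIntegral.integral_of_le h]
  · simp [Set.Ioc_eq_empty_of_le h, integral_indicator, intervalIntegral.integral_of_ge h,
      integral_neg]

/-- The integral of a compactly supported bounded function over a moving half-space is
differentiable, if the function is continuous at almost every point of the bounding hyperplane. -/
theorem hasFDerivAt_integral_heaviside {r : Params n (m + 1)} {i : Fin n} (hr : weight r i ≠ 0)
    {f : E (m + 1) → ℝ} (hf : Integrable f) {K R : ℝ} (hK : ∀ x, |f x| ≤ K)
    (hR : ∀ x, R < ‖x‖ → f x = 0) (hcont : ∀ᵐ x ∂(breakingDelta r i), ContinuousAt f x) :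
    HasFDerivAt (fun s : Params n (m + 1) => ∫ x, f x * heaviside (preact s i x))
      (∫ x, f x • preactL i x ∂(breakingDelta r i)) r := by
  obtain ⟨k, hk⟩ := exists_weight_coord_ne_zero hr
  have hK0 : 0 ≤ K := (abs_nonneg _).trans (hK 0)
  have hmH : ∀ s : Params n (m + 1), Measurable fun x => heaviside (preact s i x) := fun s =>
    measurable_heaviside.comp (continuous_preact_right s i).measurable
  have hint : ∀ s : Params n (m + 1), Integrable fun x => f x * heaviside (preact s i x) := by
    intro s
    refine hf.mul_bdd (c := 1) (hmH s).aestronglyMeasurable (.of_forall fun x => ?_)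
    exact abs_heaviside_le_one _
  set G : Params n (m + 1) → ℝ × (Fin m → ℝ) → ℝ := fun s p =>
    f (ins k p) * (heaviside (preact s i (ins k p)) - heaviside (preact r i (ins k p))) with hG
  have hGint : ∀ s, Integrable (G s) (volume.prod volume) := by
    intro s
    have h1 := (measurePreserving_ins k).integrable_comp_of_integrable ((hint s).sub (hint r))
    refine h1.congr (.of_forall fun p => ?_)
    simp [hG, mul_sub]
  -- The increment of the half-space integral, sliced into lines in direction `k`.
  set F : Params n (m + 1) → (Fin m → ℝ) → ℝ := fun s z => ∫ t, G s (t, z) with hF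
  have hFub : ∀ s, ∫ z, F s z = (∫ x, f x * heaviside (preact s i x)) -
      ∫ x, f x * heaviside (preact r i x) := by
    intro s
    rw [hF, ← integral_prod_symm _ (hGint s), ← integral_sub (hint s) (hint r),
      ← (measurePreserving_ins k).integral_comp (ins k).measurableEmbedding]
    refine integral_congr_ae (.of_forall fun p => ?_)
    simp [hG, mul_sub]
  -- Near `r` the `k`-th weight keeps its sign, which makes `F s z` an interval integral, and stays
  -- away from zero, which makes the height Lipschitz.
  have hFeq : ∀ᶠ s in 𝓝 r, |r (i, k.succ)| / 2 ≤ |s (i, k.succ)| ∧ ∀ z, F s z =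
      -SignType.sign (r (i, k.succ)) *
        ∫ t in height k r i z..height k s i z, f (ins k (t, z)) := by
    have hc : ContinuousAt (fun s : Params n (m + 1) => r (i, k.succ) * s (i, k.succ)) r :=
      (continuous_const.mul (continuous_apply _)).continuousAt
    have hc' : ContinuousAt (fun s : Params n (m + 1) => |s (i, k.succ)|) r :=
      (continuous_apply _).abs.continuousAt
    have hp : 0 < |r (i, k.succ)| := abs_pos.2 hk
    filter_upwards [hc.eventually_const_lt (mul_self_pos.2 hk),
      hc'.eventually_const_lt (half_lt_self hp)] with s hs hs'
    refine ⟨hs'.le, fun z => ?_⟩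
    rw [← integral_mul_heaviside_sub hs]
    have hs0 : s (i, k.succ) ≠ 0 := right_ne_zero_of_mul hs.ne'
    simp only [hF, hG, preact_ins_height hs0, preact_ins_height hk]
  obtain ⟨B, hB⟩ : ∃ B, ∀ z ∈ Metric.closedBall (0 : Fin m → ℝ) R,
      ‖preactL i (graphPt k r i z)‖ ≤ B :=
    (isCompact_closedBall _ _).exists_bound_of_continuousOn
      ((continuous_preactL i).comp (continuous_graphPt k r i)).continuousOn
  -- The sup norm of `z` is at most the Euclidean norm of the point above it, so lines over `z`
  -- outside the ball miss the support of `f`.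
  have hext : ∀ z, z ∉ Metric.closedBall (0 : Fin m → ℝ) R → ∀ t, f (ins k (t, z)) = 0 := by
    intro z hz t
    rw [mem_closedBall_zero_iff, not_le] at hz
    refine hR _ (hz.trans_le ((pi_norm_le_iff_of_nonneg (norm_nonneg _)).2 fun j => ?_))
    rw [← ins_succAbove k t z j]
    exact PiLp.norm_apply_le _ _
  have hlip : ∀ s : Params n (m + 1), |r (i, k.succ)| / 2 ≤ |s (i, k.succ)| →
      ∀ z ∈ Metric.closedBall (0 : Fin m → ℝ) R,
        |height k s i z - height k r i z| ≤ B * (2 / |r (i, k.succ)|) * ‖s - r‖ := by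
    intro s hs z hz
    have hp : 0 < |r (i, k.succ)| := abs_pos.2 hk
    have hs0 : s (i, k.succ) ≠ 0 := abs_pos.1 (by linarith)
    have h1 : s (i, k.succ) * (height k r i z - height k s i z) =
        preactL i (graphPt k r i z) (s - r) := by
      rw [map_sub, preactL_apply, preactL_apply, graphPt, preact_ins_height hs0,
        preact_ins_height hk, sub_self, mul_zero, sub_zero]
    have h2 := ((preactL i (graphPt k r i z)).le_opNorm (s - r)).trans
      (mul_le_mul_of_nonneg_right (hB z hz) (norm_nonneg _))
    rw [← h1, Real.norm_eq_abs, abs_mul, abs_sub_comm] at h2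
    have h3 := (mul_le_mul_of_nonneg_right hs (abs_nonneg _)).trans h2
    rw [mul_div_assoc', div_mul_eq_mul_div, le_div_iff₀ hp]
    linarith
  have hmap : ∀ᵐ x ∂(Measure.map (graphPt k r i) volume), ContinuousAt f x := by
    rw [breakingDelta_eq_map hk] at hcont
    exact (Measure.ae_ennreal_smul_measure_iff (by simpa using hk)).1 hcont
  have hcontz : ∀ᵐ z : Fin m → ℝ, ContinuousAt f (graphPt k r i z) :=
    ae_of_ae_map (continuous_graphPt k r i).aemeasurable hmap
  have hslice : ∀ᵐ z : Fin m → ℝ, Integrable fun t => f (ins k (t, z)) :=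
    ((measurePreserving_ins k).integrable_comp_of_integrable hf).prod_left_ae
  have key : Integrable (fun z => (SignType.sign (r (i, k.succ)) * f (graphPt k r i z) *
        (r (i, k.succ))⁻¹) • preactL i (graphPt k r i z)) ∧
      HasFDerivAt (fun s : Params n (m + 1) => ∫ z, F s z)
        (∫ z, (SignType.sign (r (i, k.succ)) * f (graphPt k r i z) *
        (r (i, k.succ))⁻¹) • preactL i (graphPt k r i z)) r := by
    refine hasFDerivAt_integral_of_dominated_loc_of_lip'
      (bound := (Metric.closedBall (0 : Fin m → ℝ) R).indicator
        fun _ => K * (B * (2 / |r (i, k.succ)|)))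
      hFeq (fun s _ => (hGint s).integral_prod_right.aestronglyMeasurable) ?_ ?_ ?_ ?_ ?_
    · exact (hGint r).integral_prod_right
    · have h1 : AEStronglyMeasurable (fun z => f (graphPt k r i z)) volume :=
        aestronglyMeasurable_of_ae_continuousAt (hcontz.mono fun z hz =>
          ContinuousAt.comp (f := graphPt k r i) hz (continuous_graphPt k r i).continuousAt)
      exact ((h1.const_mul _).mul_const _).smul
        ((continuous_preactL i).comp (continuous_graphPt k r i)).aestronglyMeasurable
    · refine .of_forall fun z s hs => ?_
      have h0 : F r z = 0 := by simp [hF, hG]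
      rw [h0, sub_zero, hs.2 z]
      by_cases hz : z ∈ Metric.closedBall (0 : Fin m → ℝ) R
      · rw [Set.indicator_of_mem hz, norm_mul]
        have h1 : ‖-((SignType.sign (r (i, k.succ)) : SignType) : ℝ)‖ = 1 := by
          rcases lt_or_gt_of_ne hk with h | h
          · simp [sign_neg h]
          · simp [sign_pos h]
        rw [h1, one_mul, mul_assoc]
        refine (intervalIntegral.norm_integral_le_of_norm_le_const fun t _ => hK _).trans ?_
        exact mul_le_mul_of_nonneg_left (hlip s hs.1 z hz) hK0
      · rw [Set.indicator_of_notMem hz]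
        simp [hext z hz]
    · exact (integrable_indicator_iff measurableSet_closedBall).2
        (integrableOn_const measure_closedBall_lt_top.ne)
    · filter_upwards [hcontz, hslice] with z hz hsl
      have hct : ContinuousAt (fun t => f (ins k (t, z))) (height k r i z) :=
        ContinuousAt.comp (f := fun t => ins k (t, z)) hz
          ((continuous_ins k).comp (Continuous.prodMk_left z)).continuousAt
      -- The fundamental theorem at the degenerate interval whose two endpoints are the height for
      -- `r`; it asks for continuity at that single point.
      have h1 := intervalIntegral.integral_hasDerivAt_right
        (a := height k r i z) (b := height k r i z) (f := fun t => f (ins k (t, z)))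
        IntervalIntegrable.refl (hsl.aestronglyMeasurable.stronglyMeasurableAtFilter) hct
      have h2 := (h1.comp_hasFDerivAt r (hasFDerivAt_height hk z)).const_mul
        (-((SignType.sign (r (i, k.succ)) : SignType) : ℝ))
      refine (h2.congr_fderiv ?_).congr_of_eventuallyEq (hFeq.mono fun s hs => hs.2 z)
      ext h
      simp [graphPt]
      ring
  have h1 : HasFDerivAt (fun s : Params n (m + 1) => ∫ x, f x * heaviside (preact s i x)) _ r :=
    (key.2.add_const (∫ x, f x * heaviside (preact r i x))).congr_of_eventuallyEq
      (.of_forall fun s => by simp only [hFub]; ring)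
  refine h1.congr_fderiv ?_
  have hm : AEStronglyMeasurable f (Measure.map (graphPt k r i) volume) :=
    aestronglyMeasurable_of_ae_continuousAt hmap
  have hsm : AEStronglyMeasurable (fun x => f x • preactL i x)
      (Measure.map (graphPt k r i) volume) :=
    hm.smul (continuous_preactL i).aestronglyMeasurable
  rw [breakingDelta_eq_map hk, integral_smul_measure,
    integral_map (continuous_graphPt k r i).aemeasurable hsm,
    ← integral_smul, ENNReal.toReal_ofReal (by positivity)]
  congr 1 with z : 1
  rw [smul_smul]
  congr 1
  -- The sign of `ω_{ik}` times its inverse is `|ω_{ik}|⁻¹`, the density from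
  -- `breakingDelta_eq_map`.
  rcases lt_or_gt_of_ne hk with h | h
  · simp [sign_neg h, abs_of_neg h, mul_comm]
  · simp [sign_pos h, abs_of_pos h, mul_comm]

theorem breakingDelta_closedBall_lt_top {r : Params n (m + 1)} {i : Fin n} (hr : weight r i ≠ 0)
    (R : ℝ) : breakingDelta r i (Metric.closedBall 0 R) < ⊤ := by
  obtain ⟨k, hk⟩ := exists_weight_coord_ne_zero hr
  rw [breakingDelta_eq_map hk, Measure.smul_apply, smul_eq_mul,
    Measure.map_apply (continuous_graphPt k r i).measurable measurableSet_closedBall]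
  refine ENNReal.mul_lt_top ENNReal.ofReal_lt_top ((measure_mono fun z hz => ?_).trans_lt
    (measure_closedBall_lt_top (x := (0 : Fin m → ℝ)) (r := R)))
  rw [Set.mem_preimage, mem_closedBall_zero_iff] at hz
  rw [mem_closedBall_zero_iff]
  refine ((pi_norm_le_iff_of_nonneg (norm_nonneg _)).2 fun j => ?_).trans hz
  rw [graphPt, ← ins_succAbove k (height k r i z) z j]
  exact PiLp.norm_apply_le _ _

theorem integrable_breakingDelta {r : Params n (m + 1)} {i : Fin n} (hr : weight r i ≠ 0)
    {f : E (m + 1) → ℝ} {K R : ℝ} (hK : ∀ x, |f x| ≤ K) (hR : ∀ x, R < ‖x‖ → f x = 0)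
    (hcont : ∀ᵐ x ∂(breakingDelta r i), ContinuousAt f x) :
    Integrable f (breakingDelta r i) := by
  have h1 : IntegrableOn f (Metric.closedBall 0 R) (breakingDelta r i) :=
    Measure.integrableOn_of_bounded (breakingDelta_closedBall_lt_top hr R).ne
      (aestronglyMeasurable_of_ae_continuousAt hcont) (.of_forall hK)
  refine (integrableOn_iff_integrable_of_support_subset fun x hx => ?_).1 h1
  by_contra h
  exact hx (hR x (by simpa using h))

end HalfSpace

/-! ### The classical Hessian -/

section Classical

variable {n m : ℕ} {Ω : Set (E (m + 1))} {μ u : E (m + 1) → ℝ}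

/-- The integrand of the residual matrix, extended by zero. -/
def residIntegrand (Ω : Set (E (m + 1))) (μ u : E (m + 1) → ℝ) (c₀ : ℝ)
    (c : Fin n → ℝ) (r : Params n (m + 1)) (w : E (m + 1) → ℝ) : E (m + 1) → ℝ :=
  Ω.indicator fun x => μ x * (network c₀ c r x - u x) * w x

/-- These are the requirements of `hasFDerivAt_integral_heaviside`. Extension by zero preserves
continuity off the frontier: inside `Ω` the factors are continuous, outside the closure the function
is locally zero. -/
theorem residIntegrand_spec (hΩ_open : IsOpen Ω) (hΩ_bdd : Bornology.IsBounded Ω)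
    (hμ : IntegrableOn μ Ω) (hu : AEStronglyMeasurable u (volume.restrict Ω))
    {K : ℝ} (hK : ∀ x ∈ Ω, |μ x| ≤ K ∧ |u x| ≤ K) (c₀ : ℝ) (c : Fin n → ℝ)
    {r : Params n (m + 1)} {w : E (m + 1) → ℝ} (hw : Continuous w) :
    Integrable (residIntegrand Ω μ u c₀ c r w) ∧
    (∃ B, ∀ x, |residIntegrand Ω μ u c₀ c r w x| ≤ B) ∧
    (∃ R, ∀ x, R < ‖x‖ → residIntegrand Ω μ u c₀ c r w x = 0) ∧
    ∀ x, x ∉ frontier Ω → (x ∈ Ω → ContinuousAt μ x ∧ ContinuousAt u x) →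
      ContinuousAt (residIntegrand Ω μ u c₀ c r w) x := by
  obtain ⟨C, hC1, hC⟩ := exists_network_bound (n := n) hΩ_bdd c₀ c
  obtain ⟨W, hW⟩ := hΩ_bdd.isCompact_closure.exists_bound_of_continuousOn hw.continuousOn
  have hb : ∀ x ∈ Ω, |(network c₀ c r x - u x) * w x| ≤ (C * (1 + ‖r‖) + K) * W := by
    intro x hx
    rw [abs_mul]
    exact mul_le_mul ((abs_sub _ _).trans (add_le_add ((hC x hx).2.2 r) (hK x hx).2))
      (hW x (subset_closure hx)) (abs_nonneg _)
      ((abs_nonneg _).trans ((abs_sub _ _).trans (add_le_add ((hC x hx).2.2 r) (hK x hx).2)))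
  refine ⟨?_, ⟨|K * ((C * (1 + ‖r‖) + K) * W)|, fun x => ?_⟩, ?_, fun x hx hc => ?_⟩
  · refine (integrable_indicator_iff hΩ_open.measurableSet).2 ?_
    simp_rw [mul_assoc]
    refine Integrable.mul_bdd (c := (C * (1 + ‖r‖) + K) * W) hμ
      ((aestronglyMeasurable_resid hu c₀ c r).mul hw.aestronglyMeasurable) ?_
    filter_upwards [ae_restrict_mem hΩ_open.measurableSet] with x hx using hb x hx
  · by_cases hx : x ∈ Ω
    · rw [residIntegrand, Set.indicator_of_mem hx, mul_assoc, abs_mul]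
      exact (mul_le_mul (hK x hx).1 (hb x hx) (abs_nonneg _)
        ((abs_nonneg _).trans (hK x hx).1)).trans (le_abs_self _)
    · rw [residIntegrand, Set.indicator_of_notMem hx, abs_zero]
      exact abs_nonneg _
  · obtain ⟨R, hR⟩ := hΩ_bdd.exists_norm_le
    exact ⟨R, fun x hx => Set.indicator_of_notMem (fun h => hx.not_ge (hR x h)) _⟩
  · by_cases hxΩ : x ∈ Ω
    · have h1 : ContinuousAt (fun x => μ x * (network c₀ c r x - u x) * w x) x :=
        ((hc hxΩ).1.mul ((continuous_network_right c₀ c r).continuousAt.sub (hc hxΩ).2)).mul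
          hw.continuousAt
      refine h1.congr ?_
      filter_upwards [hΩ_open.mem_nhds hxΩ] with y hy
      rw [residIntegrand, Set.indicator_of_mem hy]
    · have h1 : x ∈ (closure Ω)ᶜ := fun h => hx ⟨h, fun h' => hxΩ (interior_subset h')⟩
      refine (continuousAt_const (y := (0 : ℝ))).congr ?_
      filter_upwards [isClosed_closure.isOpen_compl.mem_nhds h1] with y hy
      rw [residIntegrand, Set.indicator_of_notMem fun h => hy (subset_closure h)]

theorem integrable_residIntegrand_smul_preactL (hΩ_open : IsOpen Ω)
    (hΩ_bdd : Bornology.IsBounded Ω)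
    (hμ : IntegrableOn μ Ω) (hu : AEStronglyMeasurable u (volume.restrict Ω))
    {K : ℝ} (hK : ∀ x ∈ Ω, |μ x| ≤ K ∧ |u x| ≤ K) (c₀ : ℝ) (c : Fin n → ℝ)
    {r : Params n (m + 1)} {i : Fin n} (hr : weight r i ≠ 0)
    (hcont : ∀ᵐ x ∂(breakingDelta r i),
        x ∉ frontier Ω ∧ (x ∈ Ω → ContinuousAt μ x ∧ ContinuousAt u x))
    {w : E (m + 1) → ℝ} (hw : Continuous w) :
    Integrable (fun x => residIntegrand Ω μ u c₀ c r w x • preactL (n := n) i x)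
      (breakingDelta r i) := by
  obtain ⟨-, ⟨B, hB⟩, ⟨R, hR⟩, hc⟩ := residIntegrand_spec hΩ_open hΩ_bdd hμ hu hK c₀ c
    (r := r) hw
  have hc' := hcont.mono fun x hx => hc x hx.1 hx.2
  obtain ⟨W, hW⟩ := hΩ_bdd.isCompact_closure.exists_bound_of_continuousOn
    (continuous_preactL (n := n) (m := m + 1) i).continuousOn
  refine Integrable.mono' ((integrable_breakingDelta hr hB hR hc').norm.mul_const W)
    ((aestronglyMeasurable_of_ae_continuousAt hc').smul
      (continuous_preactL i).aestronglyMeasurable) (.of_forall fun x => ?_)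
  rw [norm_smul]
  by_cases hx : x ∈ Ω
  · exact mul_le_mul_of_nonneg_left (hW x (subset_closure hx)) (norm_nonneg _)
  · simp [residIntegrand, hx]

/-- The product of residual and Heaviside factor is split by freezing the residual at `r`. The
varying part gives the Gauss-Newton entry, the frozen part the residual entry through the moving
half-space. -/
theorem hasFDerivAt_lossGrad (hΩ_open : IsOpen Ω) (hΩ_bdd : Bornology.IsBounded Ω)
    (hμ : IntegrableOn μ Ω) (hu : AEStronglyMeasurable u (volume.restrict Ω))
    {K : ℝ} (hK : ∀ x ∈ Ω, |μ x| ≤ K ∧ |u x| ≤ K) (c₀ : ℝ) (c : Fin n → ℝ)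
    {r : Params n (m + 1)} (hr : ∀ i, weight r i ≠ 0)
    (hcont : ∀ i, ∀ᵐ x ∂(breakingDelta r i),
        x ∉ frontier Ω ∧ (x ∈ Ω → ContinuousAt μ x ∧ ContinuousAt u x))
    (b : Fin n × Fin (m + 1 + 1)) :
    ∃ L : Params n (m + 1) →L[ℝ] ℝ,
      HasFDerivAt (fun s => lossGrad Ω μ u c₀ c s b) L r ∧
      ∀ a, L (Pi.single a 1) =
        (gaussNewton Ω μ c₀ c r + residualMatrix Ω μ u c₀ c r * scaling (m + 1) c) a b := by
  have hΩ := hΩ_open.measurableSet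
  obtain ⟨C, hC1, hC⟩ := exists_network_bound (n := n) hΩ_bdd c₀ c
  have hw : Continuous fun x : E (m + 1) => c b.1 * homog x b.2 :=
    continuous_const.mul (continuous_homog _)
  obtain ⟨hfint, ⟨B, hB⟩, ⟨R, hR⟩, hfc⟩ := residIntegrand_spec hΩ_open hΩ_bdd hμ hu hK c₀ c
    (r := r) hw
  have hfc' : ∀ᵐ x ∂(breakingDelta r b.1),
      ContinuousAt (residIntegrand Ω μ u c₀ c r fun x => c b.1 * homog x b.2) x :=
    (hcont b.1).mono fun x hx => hfc x hx.1 hx.2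
  have hS := hasFDerivAt_integral_heaviside (hr b.1) hfint hB hR hfc'
  have hSint := integrable_breakingDelta (hr b.1) hB hR hfc'
  have hmH : ∀ s : Params n (m + 1), AEStronglyMeasurable
      (fun x => c b.1 * heaviside (preact s b.1 x) * homog x b.2) (volume.restrict Ω) := fun s =>
    (((measurable_heaviside.comp (continuous_preact_right s b.1).measurable).const_mul _).mul
      (continuous_homog b.2).measurable).aestronglyMeasurable
  have hHb : ∀ s : Params n (m + 1), ∀ x ∈ Ω,
      |c b.1 * heaviside (preact s b.1 x) * homog x b.2| ≤ |c b.1| * C := by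
    intro s x hx
    rw [abs_mul, abs_mul]
    refine mul_le_mul ?_ ((hC x hx).1 _) (abs_nonneg _) (abs_nonneg _)
    exact mul_le_of_le_one_right (abs_nonneg _) (abs_heaviside_le_one _)
  set F : Params n (m + 1) → E (m + 1) → ℝ := fun s x =>
    μ x * (network c₀ c s x - network c₀ c r x) *
      (c b.1 * heaviside (preact s b.1 x) * homog x b.2) with hF
  have hFm : ∀ s, AEStronglyMeasurable (F s) (volume.restrict Ω) := fun s =>
    (hμ.aestronglyMeasurable.mul ((continuous_network_right c₀ c s).sub
      (continuous_network_right c₀ c r)).aestronglyMeasurable).mul (hmH s)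
  -- Since `F r = 0`, a Lipschitz bound at the base point `r` suffices; the jumps of the Heaviside
  -- factor elsewhere do no harm.
  have hFlip : ∀ x ∈ Ω, ∀ s, ‖F s x‖ ≤ (|μ x| * (C * (|c b.1| * C))) * ‖s - r‖ := by
    intro x hx s
    rw [Real.norm_eq_abs, hF, abs_mul, abs_mul]
    calc _ ≤ |μ x| * (C * ‖s - r‖) * (|c b.1| * C) :=
          mul_le_mul (mul_le_mul_of_nonneg_left ((hC x hx).2.1 s r) (abs_nonneg _)) (hHb s x hx)
            (abs_nonneg _) (by positivity)
      _ = _ := by ring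
  have hF0 : F r = 0 := by
    ext x
    simp [hF]
  have hFint : ∀ s, Integrable (F s) (volume.restrict Ω) := by
    intro s
    refine Integrable.mono' ((hμ.norm.mul_const (C * (|c b.1| * C))).mul_const ‖s - r‖) (hFm s) ?_
    filter_upwards [ae_restrict_mem hΩ] with x hx using hFlip x hx s
  have key : Integrable (fun x => (μ x * (c b.1 * heaviside (preact r b.1 x) * homog x b.2)) •
        networkD c r x) (volume.restrict Ω) ∧
      HasFDerivAt (fun s => ∫ x in Ω, F s x)
        (∫ x in Ω, (μ x * (c b.1 * heaviside (preact r b.1 x) * homog x b.2)) •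
        networkD c r x) r := by
    refine hasFDerivAt_integral_of_dominated_loc_of_lip' (s := Set.univ)
      (bound := fun x => |μ x| * (C * (|c b.1| * C))) univ_mem (fun s _ => hFm s) (hFint r) ?_ ?_
      (hμ.norm.mul_const _) ?_
    · exact (hμ.aestronglyMeasurable.mul (hmH r)).smul (measurable_networkD c r).aestronglyMeasurable
    · filter_upwards [ae_restrict_mem hΩ] with x hx s _
      rw [hF0, Pi.zero_apply, sub_zero]
      exact hFlip x hx s
    · refine ae_restrict_of_ae ?_
      filter_upwards [ae_preact_ne_zero hr] with x hx
      have h1 := (((hasFDerivAt_network c₀ c hx).sub_const (network c₀ c r x)).const_mul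
        (μ x)).mul_const (c b.1 * heaviside (preact r b.1 x) * homog x b.2)
      have h2 : ContinuousAt (fun s : Params n (m + 1) => preact s b.1 x) r :=
        ((continuous_preact b.1).comp (Continuous.prodMk_left x)).continuousAt
      refine (h1.congr_fderiv ?_).congr_of_eventuallyEq ?_
      · ext h
        simp
        ring
      -- Off the breaking hyperplane the Heaviside factor is locally constant in `s` and may be
      -- frozen at `r`.
      · filter_upwards [h2.eventually (heaviside_eventuallyEq (hx b.1))] with s hs
        simp only [hF, hs]
  have hsplit : ∀ s, lossGrad Ω μ u c₀ c s b = (∫ x in Ω, F s x) +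
      ∫ x, residIntegrand Ω μ u c₀ c r (fun x => c b.1 * homog x b.2) x *
        heaviside (preact s b.1 x) := by
    intro s
    have h1 : (fun x => residIntegrand Ω μ u c₀ c r (fun x => c b.1 * homog x b.2) x *
        heaviside (preact s b.1 x)) = Ω.indicator fun x => μ x * (network c₀ c r x - u x) *
          (c b.1 * heaviside (preact s b.1 x) * homog x b.2) := by
      ext x
      by_cases hx : x ∈ Ω
      · simp only [residIntegrand, Set.indicator_of_mem hx]
        ring
      · simp only [residIntegrand, Set.indicator_of_notMem hx, zero_mul]
    have h2 : Integrable (fun x => μ x * (network c₀ c r x - u x) *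
          (c b.1 * heaviside (preact s b.1 x) * homog x b.2)) (volume.restrict Ω) := by
      have h3 := hfint.mul_bdd (c := 1) (measurable_heaviside.comp
        (continuous_preact_right s b.1).measurable).aestronglyMeasurable
        (.of_forall fun x => abs_heaviside_le_one (preact s b.1 x))
      exact (integrable_indicator_iff hΩ).1 (h1 ▸ h3)
    rw [h1, integral_indicator hΩ, ← integral_add (hFint s) h2, lossGrad]
    congr 1 with x
    simp only [hF]
    ring
  refine ⟨_, (key.2.add hS).congr_of_eventuallyEq (.of_forall hsplit), fun a => ?_⟩
  rw [hessianMatrix_apply Ω μ u c₀ c hr, add_apply,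
    ContinuousLinearMap.integral_apply key.1]
  congr 1
  · rw [layerGN_apply, ← integral_const_mul]
    congr 1 with x
    simp only [smul_apply, networkD_single, smul_eq_mul]
    ring
  · have hint := integrable_residIntegrand_smul_preactL hΩ_open hΩ_bdd hμ hu hK c₀ c (hr b.1)
      (hcont b.1) hw
    rw [ContinuousLinearMap.integral_apply hint, residualMatrix_apply]
    simp only [smul_apply, preactL_single, smul_eq_mul]
    by_cases h : a.1 = b.1
    · simp only [if_pos h]
      rw [h, ← integral_mul_const, ← integral_indicator hΩ]
      congr 1 with x
      by_cases hx : x ∈ Ω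
      · simp only [residIntegrand, Set.indicator_of_mem hx]
        ring
      · simp only [residIntegrand, Set.indicator_of_notMem hx, zero_mul]
    · simp [if_neg h]

theorem residualIntegrable_of_continuousAt (hΩ_open : IsOpen Ω) (hΩ_bdd : Bornology.IsBounded Ω)
    (hμ : IntegrableOn μ Ω) (hu : AEStronglyMeasurable u (volume.restrict Ω))
    {K : ℝ} (hK : ∀ x ∈ Ω, |μ x| ≤ K ∧ |u x| ≤ K) (c₀ : ℝ) (c : Fin n → ℝ)
    {r : Params n (m + 1)} (hr : ∀ i, weight r i ≠ 0)
    (hcont : ∀ i, ∀ᵐ x ∂(breakingDelta r i),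
        x ∉ frontier Ω ∧ (x ∈ Ω → ContinuousAt μ x ∧ ContinuousAt u x)) :
    ResidualIntegrable Ω μ u c₀ c r := by
  rw [residualIntegrable_iff]
  intro i k l
  obtain ⟨-, ⟨B, hB⟩, ⟨R, hR⟩, hc⟩ := residIntegrand_spec hΩ_open hΩ_bdd hμ hu hK c₀ c
    (r := r) ((continuous_homog k).mul (continuous_homog l))
  exact (integrable_indicator_iff hΩ_open.measurableSet).1
    (integrable_breakingDelta (hr i) hB hR ((hcont i).mono fun x hx => hc x hx.1 hx.2))

theorem eventually_weight_ne_zero {d : ℕ} {r : Params n d} (hr : ∀ i, weight r i ≠ 0) :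
    ∀ᶠ s in 𝓝 r, ∀ i, weight s i ≠ 0 := by
  refine eventually_all.2 fun i => ?_
  have hc : Continuous fun s : Params n d => weight s i :=
    (PiLp.continuous_toLp 2 _).comp (continuous_pi fun k => continuous_apply _)
  exact hc.continuousAt.eventually_ne (hr i)

/-- Nonvanishing of the weights is an open condition, so near `r` the differential of the loss is
the explicit sum built from `lossGrad`, which can be differentiated at `r`. -/
theorem classical_hessian (hΩ_open : IsOpen Ω) (hΩ_bdd : Bornology.IsBounded Ω)
    (hμ_nonneg : ∀ x ∈ Ω, 0 ≤ μ x) (hμ : IntegrableOn μ Ω)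
    (hu : AEStronglyMeasurable u (volume.restrict Ω))
    (hu_sq : IntegrableOn (fun x => μ x * u x ^ 2) Ω)
    {K : ℝ} (hK : ∀ x ∈ Ω, |μ x| ≤ K ∧ |u x| ≤ K) (c₀ : ℝ) (c : Fin n → ℝ)
    {r : Params n (m + 1)} (hr : ∀ i, weight r i ≠ 0)
    (hcont : ∀ i, ∀ᵐ x ∂(breakingDelta r i),
        x ∉ frontier Ω ∧ (x ∈ Ω → ContinuousAt μ x ∧ ContinuousAt u x)) :
    (∀ᶠ s in 𝓝 r, DifferentiableAt ℝ (fun s : Params n (m + 1) => loss Ω μ u c₀ c s) s) ∧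
      DifferentiableAt ℝ (fderiv ℝ (fun s : Params n (m + 1) => loss Ω μ u c₀ c s)) r ∧
      hessian (fun s : Params n (m + 1) => loss Ω μ u c₀ c s) r =
        gaussNewton Ω μ c₀ c r + residualMatrix Ω μ u c₀ c r * scaling (m + 1) c := by
  have hgrad : ∀ᶠ s in 𝓝 r, HasFDerivAt (fun s : Params n (m + 1) => loss Ω μ u c₀ c s)
      (∑ b, lossGrad Ω μ u c₀ c s b • ContinuousLinearMap.proj (R := ℝ)
        (φ := fun _ : Fin n × Fin (m + 1 + 1) => ℝ) b) s :=
    (eventually_weight_ne_zero hr).mono fun s hs =>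
      hasFDerivAt_loss hΩ_open hΩ_bdd hμ_nonneg hμ hu hu_sq c₀ c hs
  choose L hL hLa using hasFDerivAt_lossGrad hΩ_open hΩ_bdd hμ hu hK c₀ c hr hcont
  have h2 : HasFDerivAt (fderiv ℝ (fun s : Params n (m + 1) => loss Ω μ u c₀ c s))
      (∑ b, (L b).smulRight (ContinuousLinearMap.proj (R := ℝ)
        (φ := fun _ : Fin n × Fin (m + 1 + 1) => ℝ) b)) r := by
    refine (HasFDerivAt.fun_sum fun b _ => (hL b).smul_const (ContinuousLinearMap.proj (R := ℝ)
        (φ := fun _ : Fin n × Fin (m + 1 + 1) => ℝ) b)).congr_of_eventuallyEq ?_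
    exact hgrad.mono fun s hs => hs.fderiv
  refine ⟨hgrad.mono fun s hs => hs.differentiableAt, h2.differentiableAt, ?_⟩
  ext a b
  rw [hessian, Matrix.of_apply, h2.fderiv, ← hLa]
  simp [Pi.single_apply, sum_apply]

end Classical

/-! ### Splitting off one parameter coordinate -/

section Slice

variable {ι : Type*} [Fintype ι] [DecidableEq ι]

/-- Lebesgue measure on `ℝ^ι` with the `a`-th coordinate confined to the unit interval: integrating
against it amounts to integrating over all coordinates other than the `a`-th. -/
abbrev sliceMeasure (a : ι) : Measure (ι → ℝ) :=
  volume.restrict {r | r a ∈ Set.Icc (0 : ℝ) 1}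

omit [Fintype ι] in
theorem measurable_update_prod (a : ι) :
    Measurable fun q : (ι → ℝ) × ℝ => Function.update q.1 a q.2 := by
  refine measurable_pi_iff.2 fun b => ?_
  by_cases h : b = a
  · subst h
    simpa using measurable_snd
  · simp only [Function.update_of_ne h]
    fun_prop

/-- Checked on boxes: the old `a`-th coordinate is discarded by the update and contributes only the
length 1 of the unit interval. This is Fubini in coordinate `a` without changing the index type. -/
theorem measurePreserving_update (a : ι) :
    MeasurePreserving (fun q : (ι → ℝ) × ℝ => Function.update q.1 a q.2)
      ((sliceMeasure a).prod volume) volume := by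
  refine ⟨measurable_update_prod a, (Measure.pi_eq fun s hs => ?_).symm⟩
  rw [Measure.map_apply (measurable_update_prod a) (.univ_pi hs)]
  have h1 : (fun q : (ι → ℝ) × ℝ => Function.update q.1 a q.2) ⁻¹' (Set.univ.pi s) =
      (Set.univ.pi (Function.update s a Set.univ)) ×ˢ s a := by
    ext ⟨r, t⟩
    simp only [Set.mem_preimage, Set.mem_univ_pi, Set.mem_prod]
    constructor
    · intro h
      refine ⟨fun b => ?_, by simpa using h a⟩
      by_cases hb : b = a
      · subst hb; simp
      · simpa [hb] using h b
    · rintro ⟨h, ht⟩ b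
      by_cases hb : b = a
      · subst hb; simpa using ht
      · simpa [hb] using h b
  have h2 : Set.univ.pi (Function.update s a Set.univ) ∩ {r : ι → ℝ | r a ∈ Set.Icc (0 : ℝ) 1} =
      Set.univ.pi (Function.update s a (Set.Icc 0 1)) := by
    ext r
    simp only [Set.mem_inter_iff, Set.mem_univ_pi]
    constructor
    · rintro ⟨h, ht⟩ b
      by_cases hb : b = a
      · subst hb; simpa using ht
      · simpa [hb] using h b
    · intro h
      refine ⟨fun b => ?_, by simpa using h a⟩
      by_cases hb : b = a
      · subst hb; simp
      · simpa [hb] using h b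
  have hm : MeasurableSet {r : ι → ℝ | r a ∈ Set.Icc (0 : ℝ) 1} :=
    measurableSet_Icc.preimage (measurable_pi_apply a)
  rw [h1, Measure.prod_prod, Measure.restrict_apply' hm, h2, volume_pi_pi,
    ← Finset.mul_prod_erase Finset.univ _ (Finset.mem_univ a),
    ← Finset.mul_prod_erase Finset.univ (fun i => volume (s i)) (Finset.mem_univ a)]
  rw [Function.update_self, Real.volume_Icc, sub_zero, ENNReal.ofReal_one, one_mul, mul_comm]
  congr 1
  refine Finset.prod_congr rfl fun b hb => ?_
  rw [Function.update_of_ne (Finset.ne_of_mem_erase hb)]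

theorem integral_eq_integral_update (a : ι) {f : (ι → ℝ) → ℝ} (hf : Integrable f) :
    ∫ r, f r = ∫ r, (∫ t, f (Function.update r a t)) ∂(sliceMeasure a) := by
  have hmp := measurePreserving_update a
  conv_lhs => rw [← hmp.map_eq]
  rw [integral_map hmp.measurable.aemeasurable (hmp.map_eq.symm ▸ hf.aestronglyMeasurable)]
  exact integral_prod _ (hmp.integrable_comp_of_integrable hf)

theorem lintegral_eq_lintegral_update (a : ι) {f : (ι → ℝ) → ENNReal} (hf : Measurable f) :
    ∫⁻ r, f r = ∫⁻ r, (∫⁻ t, f (Function.update r a t)) ∂(sliceMeasure a) := by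
  rw [← (measurePreserving_update a).lintegral_comp hf]
  exact lintegral_prod _ (hf.comp (measurable_update_prod a)).aemeasurable

omit [Fintype ι] in
theorem apply_update {a : ι} {ℓ : (ι → ℝ) →L[ℝ] ℝ} (hℓ : ℓ (Pi.single a 1) = 1) (r : ι → ℝ) (t : ℝ) :
    ℓ (Function.update r a t) = ℓ r + (t - r a) := by
  have : Function.update r a t = r + (t - r a) • Pi.single a 1 := by
    ext b
    by_cases hb : b = a
    · subst hb; simp
    · simp [hb]
  rw [this, map_add, map_smul, hℓ, smul_eq_mul, mul_one]

/-- The projection of `r` to the hyperplane `ℓ = 0` along the `a`-th coordinate. -/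
def slideTo (a : ι) (ℓ : (ι → ℝ) →L[ℝ] ℝ) (r : ι → ℝ) : ι → ℝ :=
  Function.update r a (r a - ℓ r)

theorem volume_setOf_apply_eq {a : ι} {ℓ : (ι → ℝ) →L[ℝ] ℝ} (hℓ : ℓ (Pi.single a 1) = 1) (t : ℝ) :
    volume {r | ℓ r = t} = 0 := by
  have hm : MeasurableSet {r | ℓ r = t} := ℓ.measurable (measurableSet_singleton t)
  rw [← (measurePreserving_update a).measure_preimage hm.nullMeasurableSet,
    Measure.measure_prod_null ((measurable_update_prod a) hm)]
  refine .of_forall fun r => ?_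
  refine measure_mono_null (t := {t - ℓ r + r a}) (fun s hs => ?_) (by simp)
  have hs : ℓ (Function.update r a s) = t := hs
  rw [apply_update hℓ] at hs
  rw [Set.mem_singleton_iff]
  linarith

theorem ae_apply_ne {a : ι} {ℓ : (ι → ℝ) →L[ℝ] ℝ} (hℓ : ℓ (Pi.single a 1) = 1) (t : ℝ) :
    ∀ᵐ r, ℓ r ≠ t :=
  measure_eq_zero_iff_ae_notMem.1 (volume_setOf_apply_eq hℓ t)

end Slice

/-! ### Integration by parts for Lipschitz functions -/

section Lipschitz

open NNReal

variable {V : Type*} [NormedAddCommGroup V] [NormedSpace ℝ V]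

theorem lineDeriv_eq_zero_of_notMem_tsupport {g : V → ℝ} {x : V} (hx : x ∉ tsupport g) (v : V) :
    lineDeriv ℝ g x v = 0 := by
  have h : g =ᶠ[𝓝 x] fun _ => 0 := notMem_tsupport_iff_eventuallyEq.1 hx
  rw [h.lineDeriv_eq]
  simp [lineDeriv]

theorem integrable_lineDeriv [MeasurableSpace V] [BorelSpace V] [FiniteDimensional ℝ V]
    {ν : Measure V} [ν.IsAddHaarMeasure] {g : V → ℝ} {D : ℝ≥0} (hg : LipschitzWith D g)
    (hc : HasCompactSupport g) (v : V) : Integrable (fun x => lineDeriv ℝ g x v) ν := by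
  refine (integrableOn_iff_integrable_of_support_subset (s := tsupport g) fun x hx => ?_).1
    ((hg.locallyIntegrable_lineDeriv v).integrableOn_isCompact hc)
  by_contra h
  exact hx (lineDeriv_eq_zero_of_notMem_tsupport h v)

omit [NormedSpace ℝ V] in
-- `f` may be unbounded, but its value is only needed at a point of the compact support of `g`; by
-- symmetry that point can be either of the two.
theorem exists_lipschitzWith_mul {f g : V → ℝ} {C D : ℝ≥0} (hf : LipschitzWith C f)
    (hg : LipschitzWith D g) (hc : HasCompactSupport g) :
    ∃ K, LipschitzWith K fun x => f x * g x := by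
  obtain ⟨A, hA⟩ := hc.isCompact.exists_bound_of_continuousOn hf.continuous.continuousOn
  obtain ⟨B, hB⟩ := hg.continuous.bounded_above_of_compact_support hc
  have h1 : ∀ x ∈ tsupport g, ∀ y, |f x * g x - f y * g y| ≤ (A * D + B * C) * dist x y := by
    intro x hx y
    have e1 : f x * g x - f y * g y = f x * (g x - g y) + g y * (f x - f y) := by ring
    have e2 := hg.dist_le_mul x y
    have e3 := hf.dist_le_mul x y
    rw [Real.dist_eq] at e2 e3
    rw [e1]
    refine (abs_add_le _ _).trans ?_
    rw [abs_mul, abs_mul, add_mul, mul_assoc, mul_assoc]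
    exact add_le_add (mul_le_mul (hA x hx) e2 (abs_nonneg _) ((abs_nonneg _).trans (hA x hx)))
      (mul_le_mul (hB y) e3 (abs_nonneg _) ((abs_nonneg _).trans (hB y)))
  refine ⟨(A * D + B * C).toNNReal, LipschitzWith.of_dist_le_mul fun x y => ?_⟩
  rw [Real.dist_eq]
  have h2 : |f x * g x - f y * g y| ≤ (A * D + B * C) * dist x y ∨ f x * g x - f y * g y = 0 := by
    by_cases hx : x ∈ tsupport g
    · exact .inl (h1 x hx y)
    · by_cases hy : y ∈ tsupport g
      · left
        rw [abs_sub_comm, dist_comm]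
        exact h1 y hy x
      · right
        rw [image_eq_zero_of_notMem_tsupport hx, image_eq_zero_of_notMem_tsupport hy]
        ring
  rcases h2 with h2 | h2
  · exact h2.trans (mul_le_mul_of_nonneg_right (Real.le_coe_toNNReal _) dist_nonneg)
  · rw [h2, abs_zero]
    positivity

theorem lineDeriv_mul {f g : V → ℝ} {x v : V} (hf : LineDifferentiableAt ℝ f x v)
    (hg : LineDifferentiableAt ℝ g x v) :
    lineDeriv ℝ (fun y => f y * g y) x v = lineDeriv ℝ f x v * g x + f x * lineDeriv ℝ g x v := by
  have h1 := hf.hasLineDerivAt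
  have h2 := hg.hasLineDerivAt
  unfold HasLineDerivAt at h1 h2
  have h3 := h1.mul h2
  simp only [zero_smul, add_zero] at h3
  exact HasLineDerivAt.lineDeriv h3

/-- Integration by parts for the square of a Lipschitz function. -/
theorem integral_sq_mul_lineDeriv [MeasurableSpace V] [BorelSpace V] [FiniteDimensional ℝ V]
    {ν : Measure V} [ν.IsAddHaarMeasure] {f g : V → ℝ} {C D : ℝ≥0} (hf : LipschitzWith C f)
    (hg : LipschitzWith D g) (hc : HasCompactSupport g) (v : V) :
    ∫ x, 1 / 2 * f x ^ 2 * lineDeriv ℝ g x v ∂ν = -∫ x, f x * lineDeriv ℝ f x v * g x ∂ν := by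
  obtain ⟨K, hK⟩ := exists_lipschitzWith_mul hf hg hc
  have hcm : HasCompactSupport fun x => f x * g x := hc.mul_left
  -- `f²` need not be globally Lipschitz, so the formula is applied to the pair `f`, `f g`. The
  -- product rule, valid almost everywhere, reproduces the left side with opposite sign; this is
  -- where the factor 1/2 comes from.
  have h1 := LipschitzWith.integral_lineDeriv_mul_eq (μ := ν) hf hK hcm v
  have h2 : ∀ᵐ x ∂ν, lineDeriv ℝ (fun y => f y * g y) x (-v) * f x =
      -(f x * lineDeriv ℝ f x v * g x) - f x ^ 2 * lineDeriv ℝ g x v := by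
    filter_upwards [hf.ae_lineDifferentiableAt v, hg.ae_lineDifferentiableAt v] with x hfx hgx
    rw [lineDeriv_neg, lineDeriv_mul hfx hgx]
    ring
  have hfc := hf.continuous
  have hi1 : Integrable (fun x => f x * lineDeriv ℝ f x v * g x) ν := by
    have e1 : Integrable (fun x => (f x * g x) * lineDeriv ℝ f x v) ν :=
      (hK.continuous.integrable_of_hasCompactSupport hcm).mul_bdd (c := C * ‖v‖)
        (aestronglyMeasurable_lineDeriv hfc ν)
        (.of_forall fun x => norm_lineDeriv_le_of_lipschitz ℝ hf)
    exact e1.congr (.of_forall fun x => by ring)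
  have hi2 : Integrable (fun x => f x ^ 2 * lineDeriv ℝ g x v) ν := by
    obtain ⟨A, hA⟩ := hc.isCompact.exists_bound_of_continuousOn (f := fun x => f x ^ 2)
      (hfc.pow 2).continuousOn
    refine Integrable.mono' ((integrable_lineDeriv (ν := ν) hg hc v).norm.const_mul A)
      ((hfc.pow 2).aestronglyMeasurable.mul (aestronglyMeasurable_lineDeriv hg.continuous ν))
      (.of_forall fun x => ?_)
    rw [norm_mul]
    by_cases hx : x ∈ tsupport g
    · exact mul_le_mul_of_nonneg_right (hA x hx) (norm_nonneg _)
    · simp [lineDeriv_eq_zero_of_notMem_tsupport hx]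
  have hi1' : Integrable (fun x => -(f x * lineDeriv ℝ f x v * g x)) ν := hi1.neg
  rw [integral_congr_ae h2, integral_sub hi1' hi2, integral_neg] at h1
  have h3 : ∫ x, lineDeriv ℝ f x v * (f x * g x) ∂ν = ∫ x, f x * lineDeriv ℝ f x v * g x ∂ν := by
    congr 1 with x
    ring
  have h4 : ∫ x, 1 / 2 * f x ^ 2 * lineDeriv ℝ g x v ∂ν =
      1 / 2 * ∫ x, f x ^ 2 * lineDeriv ℝ g x v ∂ν := by
    rw [← integral_const_mul]
    congr 1 with x
    ring
  rw [h3] at h1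
  rw [h4]
  linarith

end Lipschitz

/-! ### Lipschitz approximation of the Heaviside function -/

section Ramp

open NNReal

/-- A Lipschitz approximation of the Heaviside function. -/
def ramp (k : ℕ) (t : ℝ) : ℝ := min 1 (max 0 ((k + 1) * t))

theorem lipschitzWith_ramp (k : ℕ) : LipschitzWith (k + 1) (ramp k) := by
  have h : LipschitzWith (k + 1 : ℝ≥0) fun t : ℝ => ((k : ℝ) + 1) * t :=
    LipschitzWith.of_dist_le_mul fun s t => by
      rw [Real.dist_eq, Real.dist_eq, ← mul_sub, abs_mul, abs_of_nonneg (by positivity)]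
      simp
  exact (h.const_max 0).const_min 1

theorem abs_ramp_le_one (k : ℕ) (t : ℝ) : |ramp k t| ≤ 1 := by
  rw [abs_of_nonneg (le_min zero_le_one (le_max_left _ _))]
  exact min_le_left _ _

theorem tendsto_ramp (t : ℝ) : Tendsto (fun k => ramp k t) atTop (𝓝 (heaviside t)) := by
  rcases le_or_gt t 0 with ht | ht
  · have : ∀ k : ℕ, ramp k t = 0 := fun k => by
      rw [ramp, max_eq_left (mul_nonpos_of_nonneg_of_nonpos (by positivity) ht)]
      simp
    simp [this, heaviside, ht.not_gt]
  · rw [heaviside, if_pos ht]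
    obtain ⟨N, hN⟩ := exists_nat_gt (1 / t)
    refine tendsto_const_nhds.congr' ?_
    filter_upwards [eventually_ge_atTop N] with k hk
    have h1 : 1 ≤ (k + 1) * t := by
      rw [div_lt_iff₀ ht] at hN
      have : (N : ℝ) ≤ k := by exact_mod_cast hk
      nlinarith
    rw [ramp, max_eq_right (by linarith), min_eq_left h1]

theorem hasDerivAt_ramp {k : ℕ} {t : ℝ} (h0 : t ≠ 0) (h1 : t ≠ (k + 1 : ℝ)⁻¹) :
    HasDerivAt (ramp k) ((Set.Ioc 0 (k + 1 : ℝ)⁻¹).indicator (fun _ => (k + 1 : ℝ)) t) t := by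
  have hk : (0 : ℝ) < k + 1 := by positivity
  have hlin : HasDerivAt (fun s : ℝ => ((k : ℝ) + 1) * s) (k + 1) t := by
    simpa using (hasDerivAt_id t).const_mul ((k : ℝ) + 1)
  have hct : ContinuousAt (fun s : ℝ => ((k : ℝ) + 1) * s) t := hlin.continuousAt
  rcases lt_or_gt_of_ne h0 with h | h
  · rw [Set.indicator_of_notMem fun hm => h.not_gt hm.1]
    refine (hasDerivAt_const t (0 : ℝ)).congr_of_eventuallyEq ?_
    filter_upwards [eventually_lt_nhds h] with s hs
    rw [ramp, max_eq_left (mul_nonpos_of_nonneg_of_nonpos hk.le hs.le), min_eq_right zero_le_one]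
  · rcases lt_or_gt_of_ne h1 with h' | h'
    · rw [Set.indicator_of_mem (Set.mem_Ioc.2 ⟨h, h'.le⟩)]
      refine hlin.congr_of_eventuallyEq ?_
      filter_upwards [eventually_gt_nhds h, eventually_lt_nhds h'] with s hs hs'
      have hs : 0 < s := hs
      have h2 := mul_le_mul_of_nonneg_left (le_of_lt hs') hk.le
      rw [mul_inv_cancel₀ hk.ne'] at h2
      rw [ramp, max_eq_right (by positivity), min_eq_right h2]
    · rw [Set.indicator_of_notMem fun hm => h'.not_ge hm.2]
      refine (hasDerivAt_const t (1 : ℝ)).congr_of_eventuallyEq ?_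
      filter_upwards [eventually_gt_nhds h'] with s hs
      have h2 := mul_le_mul_of_nonneg_left (le_of_lt hs) hk.le
      rw [mul_inv_cancel₀ hk.ne'] at h2
      rw [ramp, max_eq_right (by linarith), min_eq_left h2]

end Ramp

/-! ### Integration by parts over a half-space -/

section HalfSpaceParts

open NNReal

variable {ι : Type*} [Fintype ι] [DecidableEq ι]

/-- Bounded support after an update still bounds `r` on the slice: the overwritten coordinate lies
in the unit interval, hence the radius `max R 1`. -/
theorem mem_closedBall_of_update {a : ι} {r : ι → ℝ} (hr : r a ∈ Set.Icc (0 : ℝ) 1) {t R : ℝ}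
    (h : Function.update r a t ∈ Metric.closedBall (0 : ι → ℝ) R) :
    r ∈ Metric.closedBall (0 : ι → ℝ) (max R 1) := by
  rw [mem_closedBall_zero_iff] at h ⊢
  refine (pi_norm_le_iff_of_nonneg (zero_le_one.trans (le_max_right _ _))).2 fun b => ?_
  by_cases hb : b = a
  · subst hb
    rw [Real.norm_eq_abs, abs_of_nonneg hr.1]
    exact hr.2.trans (le_max_right _ _)
  · have h1 := (norm_le_pi_norm (Function.update r a t) b).trans h
    rw [Function.update_of_ne hb] at h1
    exact h1.trans (le_max_left _ _)

omit [DecidableEq ι] in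
theorem ae_slice_mem (a : ι) : ∀ᵐ r ∂(sliceMeasure a), r a ∈ Set.Icc (0 : ℝ) 1 :=
  ae_restrict_mem (measurableSet_Icc.preimage (measurable_pi_apply a))

/-- Integration by parts over the half-space `ℓ > 0`. -/
theorem integral_heaviside_mul_lineDeriv {a : ι} {ℓ : (ι → ℝ) →L[ℝ] ℝ}
    (hℓ : ℓ (Pi.single a 1) = 1) {g : (ι → ℝ) → ℝ} {D : ℝ≥0} (hg : LipschitzWith D g)
    (hc : HasCompactSupport g) (w : ι → ℝ) :
    ∫ r, heaviside (ℓ r) * lineDeriv ℝ g r w =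
      -(ℓ w * ∫ r, g (slideTo a ℓ r) ∂(sliceMeasure a)) := by
  have hgc := hg.continuous
  -- Average of `g` over the segment in direction `a` on which `0 < ℓ ≤ 1 / (k + 1)`, rescaled to
  -- unit length. This is what the derivative of the ramp integrates to.
  set P : ℕ → (ι → ℝ) → ℝ := fun k r =>
    ∫ s in (0 : ℝ)..1, g (Function.update r a (s / (k + 1) + (r a - ℓ r))) with hP
  obtain ⟨M, hM⟩ := hgc.bounded_above_of_compact_support hc
  obtain ⟨R, hR⟩ := hc.isCompact.isBounded.subset_closedBall (0 : ι → ℝ)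
  have hstep : ∀ k : ℕ, ∫ r, lineDeriv ℝ g r (-w) * ramp k (ℓ r) =
      ℓ w * ∫ r, P k r ∂(sliceMeasure a) := by
    intro k
    have hk : (0 : ℝ) < k + 1 := by positivity
    refine (LipschitzWith.integral_lineDeriv_mul_eq ((lipschitzWith_ramp k).comp ℓ.lipschitz)
      hg hc w).symm.trans ?_
    have h1 : ∀ᵐ r, lineDeriv ℝ (ramp k ∘ ℓ) r w * g r = ℓ w *
        ((Set.Ioc 0 (k + 1 : ℝ)⁻¹).indicator (fun _ => (k + 1 : ℝ)) (ℓ r) * g r) := by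
      filter_upwards [ae_apply_ne hℓ 0, ae_apply_ne hℓ (k + 1 : ℝ)⁻¹] with r h0 h1
      have h2 := ((hasDerivAt_ramp h0 h1).comp_hasFDerivAt r ℓ.hasFDerivAt).hasLineDerivAt w
      rw [h2.lineDeriv]
      simp only [smul_apply, smul_eq_mul]
      ring
    have hind : Measurable fun t : ℝ =>
        (Set.Ioc 0 (k + 1 : ℝ)⁻¹).indicator (fun _ => (k + 1 : ℝ)) t :=
      measurable_const.indicator measurableSet_Ioc
    have hint : Integrable fun r =>
        (Set.Ioc 0 (k + 1 : ℝ)⁻¹).indicator (fun _ => (k + 1 : ℝ)) (ℓ r) * g r := by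
      refine (hgc.integrable_of_hasCompactSupport hc).bdd_mul (c := k + 1)
        (hind.comp ℓ.measurable).aestronglyMeasurable (.of_forall fun r => ?_)
      refine (norm_indicator_le_norm_self _ _).trans_eq ?_
      rw [Real.norm_of_nonneg hk.le]
    rw [integral_congr_ae h1, integral_const_mul, integral_eq_integral_update a hint]
    congr 1
    refine integral_congr_ae (.of_forall fun r => ?_)
    simp only [hP, apply_update hℓ]
    rw [intervalIntegral.integral_comp_div_add (fun t => g (Function.update r a t)) hk.ne',
      intervalIntegral.integral_of_le (by simp [hk.le]), ← integral_indicator measurableSet_Ioc,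
      ← integral_smul]
    congr 1 with t
    have hmem : ℓ r + (t - r a) ∈ Set.Ioc 0 (k + 1 : ℝ)⁻¹ ↔
        t ∈ Set.Ioc (0 / (k + 1 : ℝ) + (r a - ℓ r)) (1 / (k + 1 : ℝ) + (r a - ℓ r)) := by
      rw [zero_div, one_div, Set.mem_Ioc, Set.mem_Ioc]
      constructor <;> rintro ⟨h, h'⟩ <;> constructor <;> linarith
    by_cases ht : ℓ r + (t - r a) ∈ Set.Ioc 0 (k + 1 : ℝ)⁻¹
    · rw [Set.indicator_of_mem ht, Set.indicator_of_mem (hmem.1 ht), smul_eq_mul]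
    · rw [Set.indicator_of_notMem ht, Set.indicator_of_notMem (fun h => ht (hmem.2 h)), zero_mul,
        smul_zero]
  have hlim1 : Tendsto (fun k : ℕ => ∫ r, lineDeriv ℝ g r (-w) * ramp k (ℓ r)) atTop
      (𝓝 (∫ r, lineDeriv ℝ g r (-w) * heaviside (ℓ r))) := by
    refine tendsto_integral_of_dominated_convergence (fun r => ‖lineDeriv ℝ g r (-w)‖)
      (fun k => ?_) (integrable_lineDeriv hg hc _).norm (fun k => .of_forall fun r => ?_)
      (.of_forall fun r => (tendsto_ramp _).const_mul _)
    · exact (aestronglyMeasurable_lineDeriv hgc _).mul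
        ((lipschitzWith_ramp k).continuous.comp ℓ.continuous).aestronglyMeasurable
    · rw [norm_mul]
      exact mul_le_of_le_one_right (norm_nonneg _) (abs_ramp_le_one _ _)
  have hlim2 : Tendsto (fun k : ℕ => ∫ r, P k r ∂(sliceMeasure a)) atTop
      (𝓝 (∫ r, g (slideTo a ℓ r) ∂(sliceMeasure a))) := by
    refine tendsto_integral_of_dominated_convergence
      ((Metric.closedBall (0 : ι → ℝ) (max R 1)).indicator fun _ => M) (fun k => ?_) ?_
      (fun k => ?_) (.of_forall fun r => ?_)
    · refine Continuous.aestronglyMeasurable ?_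
      refine intervalIntegral.continuous_parametric_intervalIntegral_of_continuous' ?_ 0 1
      exact hgc.comp (continuous_fst.update a (by fun_prop))
    · refine (integrable_indicator_iff measurableSet_closedBall).2 (integrableOn_const ?_)
      exact ((Measure.restrict_apply_le _ _).trans_lt measure_closedBall_lt_top).ne
    · filter_upwards [ae_slice_mem a] with r hr
      by_cases hrb : r ∈ Metric.closedBall (0 : ι → ℝ) (max R 1)
      · rw [Set.indicator_of_mem hrb]
        refine (intervalIntegral.norm_integral_le_of_norm_le_const fun s _ => hM _).trans_eq ?_
        simp
      · have h0 : P k r = 0 := by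
          simp only [hP]
          refine (intervalIntegral.integral_congr fun s _ => ?_).trans intervalIntegral.integral_zero
          refine image_eq_zero_of_notMem_tsupport fun h => hrb ?_
          exact mem_closedBall_of_update hr (hR h)
        rw [h0, norm_zero, Set.indicator_of_notMem hrb]
    -- The segment has length `1 / (k + 1)` and starts at the slid point, so the average differs
    -- from the value of `g` there by at most `D / (k + 1)`.
    · rw [tendsto_iff_norm_sub_tendsto_zero]
      refine squeeze_zero (fun _ => norm_nonneg _) (fun k => ?_)
        (tendsto_const_div_atTop_nhds_zero_nat (D : ℝ) |>.comp (tendsto_add_atTop_nat 1))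
      have hk : (0 : ℝ) < k + 1 := by positivity
      have h1 : P k r - g (slideTo a ℓ r) = ∫ s in (0 : ℝ)..1,
          (g (Function.update r a (s / (k + 1) + (r a - ℓ r))) - g (slideTo a ℓ r)) := by
        rw [intervalIntegral.integral_sub]
        · simp [hP]
        · exact (hgc.comp (continuous_const.update a (by fun_prop))).intervalIntegrable _ _
        · simp
      rw [h1]
      refine (intervalIntegral.norm_integral_le_of_norm_le_const (C := D / (k + 1)) fun s hs => ?_).trans
        ?_
      · rw [Set.uIoc_of_le zero_le_one] at hs
        refine (hg.norm_sub_le _ _).trans ?_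
        rw [div_eq_mul_inv]
        refine mul_le_mul_of_nonneg_left ?_ D.coe_nonneg
        refine (pi_norm_le_iff_of_nonneg (by positivity)).2 fun b => ?_
        by_cases hb : b = a
        · subst hb
          simp only [slideTo, Pi.sub_apply, Function.update_self, add_sub_cancel_right]
          rw [Real.norm_of_nonneg (mul_nonneg hs.1.le (inv_nonneg.2 hk.le))]
          exact mul_le_of_le_one_left (by positivity) hs.2
        · simp only [slideTo, Pi.sub_apply, Function.update_of_ne hb, sub_self, norm_zero]
          positivity
      · simp
  have h1 := tendsto_nhds_unique hlim1 ((hlim2.const_mul (ℓ w)).congr fun k => (hstep k).symm)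
  rw [← h1, ← integral_neg]
  congr 1 with r
  rw [lineDeriv_neg]
  ring

end HalfSpaceParts

/-! ### Weak second derivatives at a fixed point `x` -/

section Pointwise

open NNReal

variable {n d : ℕ}

theorem exists_lipschitzWith_network (c₀ : ℝ) (c : Fin n → ℝ) (x : E d) (t : ℝ) :
    ∃ K, LipschitzWith K fun r : Params n d => network c₀ c r x - t := by
  obtain ⟨C, hC1, hC⟩ := exists_network_bound (n := n) (Bornology.isBounded_singleton (x := x)) c₀ c
  refine ⟨C.toNNReal, LipschitzWith.of_dist_le_mul fun r s => ?_⟩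
  rw [Real.dist_eq, sub_sub_sub_cancel_right, dist_eq_norm, Real.coe_toNNReal _ (by linarith)]
  exact (hC x rfl).2.1 r s

theorem preactL_single_bias (i : Fin n) (x : E d) : preactL i x (Pi.single (i, 0) 1) = 1 := by
  simp [preactL_single]

theorem ae_params_preact_ne_zero (x : E d) : ∀ᵐ r : Params n d, ∀ i, preact r i x ≠ 0 :=
  ae_all_iff.2 fun i => by
    simpa only [preactL_apply] using ae_apply_ne (preactL_single_bias i x) 0

/-- For fixed `x`, the weak Hessian of `r ↦ ½ (uₙ(x; r) - t)²`. -/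
theorem integral_sq_network_mul_hessian (c₀ : ℝ) (c : Fin n → ℝ) (x : E d) (t : ℝ)
    {φ : Params n d → ℝ} (hφ : ContDiff ℝ ∞ φ) (hc : HasCompactSupport φ)
    (a b : Fin n × Fin (d + 1)) :
    ∫ r, 1 / 2 * (network c₀ c r x - t) ^ 2 * hessian φ r a b =
      (∫ r, c a.1 * c b.1 * (heaviside (preact r a.1 x) * heaviside (preact r b.1 x) *
        (homog x a.2 * homog x b.2)) * φ r) +
      if a.1 = b.1 then ∫ r, (network c₀ c (slideTo (a.1, 0) (preactL a.1 x) r) x - t) *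
        (homog x a.2 * homog x b.2) * c b.1 * φ (slideTo (a.1, 0) (preactL a.1 x) r)
          ∂(sliceMeasure (a.1, 0)) else 0 := by
  set v : Params n d → ℝ := fun r => network c₀ c r x - t with hv
  set ψ : Params n d → ℝ := fun r => fderiv ℝ φ r (Pi.single b 1) with hψ
  obtain ⟨K, hK⟩ := exists_lipschitzWith_network c₀ c x t
  have hφd : ContDiff ℝ ∞ (fderiv ℝ φ) := hφ.fderiv_right (by simp)
  have hψs : ContDiff ℝ ∞ ψ := hφd.clm_apply contDiff_const
  have hψc : HasCompactSupport ψ := (hc.fderiv ℝ).comp_left (g := fun L : Params n d →L[ℝ] ℝ =>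
    L (Pi.single b 1)) rfl
  obtain ⟨Kφ, hKφ⟩ : ∃ Kφ, LipschitzWith Kφ φ :=
    ⟨_, hφ.lipschitzWith_of_hasCompactSupport hc (by simp) |>.choose_spec⟩
  obtain ⟨Kψ, hKψ⟩ : ∃ Kψ, LipschitzWith Kψ ψ :=
    ⟨_, hψs.lipschitzWith_of_hasCompactSupport hψc (by simp) |>.choose_spec⟩
  obtain ⟨K', hK'⟩ := exists_lipschitzWith_mul hK hKφ hc
  have hφψ : ∀ r, lineDeriv ℝ φ r (Pi.single b 1) = ψ r := fun r =>
    (hφ.differentiable (by simp) r).lineDeriv_eq_fderiv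
  have hhess : ∀ r, hessian φ r a b = lineDeriv ℝ ψ r (Pi.single a 1) := by
    intro r
    rw [(hψs.differentiable (by simp) r).lineDeriv_eq_fderiv, hessian, Matrix.of_apply, hψ,
      fderiv_clm_apply (hφd.differentiable (by simp) r) (differentiableAt_const _)]
    simp
  have hvl : ∀ᵐ r, ∀ e : Fin n × Fin (d + 1), LineDifferentiableAt ℝ v r (Pi.single e 1) ∧
      lineDeriv ℝ v r (Pi.single e 1) = c e.1 * heaviside (preact r e.1 x) * homog x e.2 := by
    filter_upwards [ae_params_preact_ne_zero x] with r hr e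
    have h := ((hasFDerivAt_network c₀ c hr).sub_const t).hasLineDerivAt (Pi.single e 1)
    exact ⟨h.lineDifferentiableAt, by rw [h.lineDeriv, networkD_single]⟩
  have hHm : ∀ i, Measurable fun r : Params n d => heaviside (preact r i x) := fun i =>
    measurable_heaviside.comp ((continuous_preact i).comp (Continuous.prodMk_left x)).measurable
  have hI1 : Integrable fun r => heaviside (preact r a.1 x) * (v r * ψ r) :=
    ((hK.continuous.mul hKψ.continuous).integrable_of_hasCompactSupport hψc.mul_left).bdd_mul
      (c := 1) (hHm a.1).aestronglyMeasurable (.of_forall fun r => abs_heaviside_le_one _)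
  have hI2 : Integrable fun r => heaviside (preact r a.1 x) *
      (c b.1 * heaviside (preact r b.1 x) * homog x b.2 * φ r) := by
    have h1 : Integrable fun r => heaviside (preact r b.1 x) * φ r :=
      (hKφ.continuous.integrable_of_hasCompactSupport hc).bdd_mul (c := 1)
        (hHm b.1).aestronglyMeasurable (.of_forall fun r => abs_heaviside_le_one _)
    have h2 := (h1.const_mul (c b.1 * homog x b.2)).bdd_mul (c := 1)
        (hHm a.1).aestronglyMeasurable (.of_forall fun r => abs_heaviside_le_one _)
    exact h2.congr (.of_forall fun r => by ring)
  -- First integration by parts, in direction `a`, with test function `ψ = ∂_b φ`.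
  have step1 : ∫ r, 1 / 2 * v r ^ 2 * hessian φ r a b =
      -(c a.1 * homog x a.2 * ∫ r, heaviside (preact r a.1 x) * (v r * ψ r)) := by
    simp_rw [hhess]
    rw [integral_sq_mul_lineDeriv hK hKψ hψc, ← integral_const_mul]
    congr 1
    refine integral_congr_ae ?_
    filter_upwards [hvl] with r hr
    rw [(hr a).2]
    ring
  -- Second one, in direction `b`, for the Lipschitz function `v φ` on the half-space of neuron
  -- `a.1`. The boundary factor is the `b`-derivative of that pre-activation, which vanishes when
  -- the neurons differ.
  have step2 : (∫ r, heaviside (preact r a.1 x) *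
        (c b.1 * heaviside (preact r b.1 x) * homog x b.2 * φ r)) +
      ∫ r, heaviside (preact r a.1 x) * (v r * ψ r) =
      -((if b.1 = a.1 then homog x b.2 else 0) *
        ∫ r, v (slideTo (a.1, 0) (preactL a.1 x) r) * φ (slideTo (a.1, 0) (preactL a.1 x) r)
          ∂(sliceMeasure (a.1, 0))) := by
    have h1 := integral_heaviside_mul_lineDeriv (preactL_single_bias a.1 x) hK' hc.mul_left
      (Pi.single b 1)
    rw [preactL_single] at h1
    rw [← h1, ← integral_add hI2 hI1]
    refine integral_congr_ae ?_
    filter_upwards [hvl] with r hr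
    have h2 := lineDeriv_mul (hr b).1 (hφ.differentiable (by simp) r).lineDifferentiableAt
    rw [h2, (hr b).2, hφψ, preactL_apply]
    ring
  rw [step1, ← sub_eq_iff_eq_add'.2 step2.symm]
  have h3 : ∫ r, c a.1 * c b.1 * (heaviside (preact r a.1 x) * heaviside (preact r b.1 x) *
        (homog x a.2 * homog x b.2)) * φ r = c a.1 * homog x a.2 *
      ∫ r, heaviside (preact r a.1 x) *
        (c b.1 * heaviside (preact r b.1 x) * homog x b.2 * φ r) := by
    rw [← integral_const_mul]
    congr 1 with r
    ring
  rw [h3]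
  by_cases hab : a.1 = b.1
  · have h4 : ∫ r, v (slideTo (a.1, 0) (preactL a.1 x) r) *
        (homog x a.2 * homog x b.2) * c b.1 * φ (slideTo (a.1, 0) (preactL a.1 x) r)
          ∂(sliceMeasure (a.1, 0)) = c a.1 * homog x a.2 * homog x b.2 *
        ∫ r, v (slideTo (a.1, 0) (preactL a.1 x) r) * φ (slideTo (a.1, 0) (preactL a.1 x) r)
          ∂(sliceMeasure (a.1, 0)) := by
      rw [← integral_const_mul, ← hab]
      congr 1 with r
      ring
    rw [if_pos hab, if_pos hab.symm, h4]
    ring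
  · rw [if_neg hab, if_neg (Ne.symm hab)]
    ring

end Pointwise

/-! ### The coarea identity on the incidence set -/

section Coarea

variable {n m : ℕ}

theorem measurable_slide (i : Fin n) : Measurable fun q : Params n m × E m =>
    (slideTo (i, 0) (preactL i q.2) q.1, q.2) := by
  refine Measurable.prodMk (measurable_pi_iff.2 fun b => ?_) measurable_snd
  have h : Measurable fun q : Params n m × E m => preact q.1 i q.2 :=
    (continuous_preact i).measurable
  by_cases hb : b = (i, 0)
  · subst hb
    simp only [slideTo, preactL_apply, Function.update_self]
    fun_prop
  · simp only [slideTo, Function.update_of_ne hb]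
    fun_prop

theorem measurable_graph (k : Fin (m + 1)) (i : Fin n) :
    Measurable fun q : Params n (m + 1) × (Fin m → ℝ) => (q.1, graphPt k q.1 i q.2) :=
  measurable_fst.prodMk (measurable_graphPt k i)

/-- The density `|ω_{ik}|⁻¹`. -/
abbrev coordMeasure (k : Fin (m + 1)) (i : Fin n) : Measure (Params n (m + 1)) :=
  volume.withDensity fun r => ENNReal.ofReal |r (i, k.succ)|⁻¹

theorem measurable_coordDensity (k : Fin (m + 1)) (i : Fin n) :
    Measurable fun r : Params n (m + 1) => ENNReal.ofReal |r (i, k.succ)|⁻¹ := by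
  have h : Measurable fun r : Params n (m + 1) => r (i, k.succ) := measurable_pi_apply _
  exact ENNReal.measurable_ofReal.comp (measurable_norm.comp h).inv

theorem ae_coord_ne_zero {ι : Type*} [Fintype ι] [DecidableEq ι] (a : ι) :
    ∀ᵐ r : ι → ℝ, r a ≠ 0 :=
  ae_apply_ne (ℓ := ContinuousLinearMap.proj (R := ℝ) (φ := fun _ : ι => ℝ) a) (a := a)
    (by simp) 0

theorem volume_absolutelyContinuous_coordMeasure (k : Fin (m + 1)) (i : Fin n) :
    (volume : Measure (Params n (m + 1))) ≪ coordMeasure k i := by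
  refine withDensity_absolutelyContinuous' (measurable_coordDensity k i).aemeasurable ?_
  filter_upwards [ae_coord_ne_zero (ι := Fin n × Fin (m + 1 + 1)) (i, k.succ)] with r hr
  simpa using hr

theorem height_update (k : Fin (m + 1)) (r : Params n (m + 1)) (i : Fin n) (t : ℝ)
    (z : Fin m → ℝ) : height k (Function.update r (i, 0) t) i z =
      -(t + ∑ j, r (i, (k.succAbove j).succ) * z j) / r (i, k.succ) := by
  simp [height, Function.update_of_ne, Fin.succ_ne_zero]

theorem slideTo_ins (k : Fin (m + 1)) (r : Params n (m + 1)) (i : Fin n) (τ : ℝ) (z : Fin m → ℝ) :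
    slideTo (i, 0) (preactL i (ins k (τ, z))) r = Function.update r (i, 0)
      (-(r (i, k.succ) * τ + ∑ j, r (i, (k.succAbove j).succ) * z j)) := by
  rw [slideTo, preactL_apply, preact_ins]
  congr 1
  ring

/-- The coarea formula for the family of breaking hyperplanes. -/
theorem map_graph_eq_map_slide (k : Fin (m + 1)) (i : Fin n) :
    Measure.map (fun q : Params n (m + 1) × (Fin m → ℝ) => (q.1, graphPt k q.1 i q.2))
      ((coordMeasure k i).prod volume) =
    Measure.map (fun q : Params n (m + 1) × E (m + 1) =>
      (slideTo (i, 0) (preactL i q.2) q.1, q.2))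
      ((sliceMeasure ((i, 0) : Fin n × Fin (m + 1 + 1))).prod volume) := by
  ext A hA
  have hA1 := measurable_graph k i hA
  have hA2 := measurable_slide i hA
  rw [Measure.map_apply (measurable_graph k i) hA, Measure.map_apply (measurable_slide i) hA,
    Measure.prod_apply hA1, Measure.prod_apply hA2,
    lintegral_withDensity_eq_lintegral_mul _ (measurable_coordDensity k i)
      (measurable_measure_prodMk_left hA1),
    -- The left side is disintegrated over the bias as well. With the other parameters and `z`
    -- fixed, it then remains to compare a bias `t` with a height `τ`.
    lintegral_eq_lintegral_update ((i, 0) : Fin n × Fin (m + 1 + 1))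
      ((measurable_coordDensity k i).mul (measurable_measure_prodMk_left hA1))]
  refine lintegral_congr_ae ?_
  filter_upwards [ae_restrict_of_ae (ae_coord_ne_zero (ι := Fin n × Fin (m + 1 + 1)) (i, k.succ))]
    with r hr
  have hupd : Measurable fun p : ℝ × (Fin m → ℝ) =>
      ((Function.update r (i, 0) p.1, p.2) : Params n (m + 1) × (Fin m → ℝ)) :=
    ((measurable_update r).comp measurable_fst).prodMk measurable_snd
  have hr1 : ∀ t : ℝ, Function.update r (i, 0) t (i, k.succ) = r (i, k.succ) := fun t => by
    rw [Function.update_of_ne (by simp [Fin.succ_ne_zero])]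
  have hB := (hupd hA1)
  have hC : MeasurableSet (Prod.mk r ⁻¹' ((fun q : Params n (m + 1) × E (m + 1) =>
      (slideTo (i, 0) (preactL i q.2) q.1, q.2)) ⁻¹' A)) := measurable_prodMk_left hA2
  simp only [Pi.mul_apply, hr1]
  rw [lintegral_const_mul' _ _ ENNReal.ofReal_ne_top]
  have e1 := Measure.prod_apply (μ := (volume : Measure ℝ)) (ν := (volume : Measure (Fin m → ℝ))) hB
  have e2 := Measure.prod_apply_symm (μ := (volume : Measure ℝ))
    (ν := (volume : Measure (Fin m → ℝ))) hB
  have e3 := Measure.prod_apply_symm (μ := (volume : Measure ℝ))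
    (ν := (volume : Measure (Fin m → ℝ))) ((ins k).measurable hC)
  have e4 := (measurePreserving_ins k).measure_preimage hC.nullMeasurableSet
  rw [Measure.volume_eq_prod, e3] at e4
  refine Eq.trans (congrArg _ (e1.symm.trans e2)) (Eq.trans ?_ e4)
  rw [← lintegral_const_mul' _ _ ENNReal.ofReal_ne_top]
  congr 1 with z
  set s : ℝ := ∑ j, r (i, (k.succAbove j).succ) * z j with hs
  set T : Set ℝ := (fun τ => (τ, z)) ⁻¹' (ins k ⁻¹' (Prod.mk r ⁻¹'
    ((fun q : Params n (m + 1) × E (m + 1) =>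
      (slideTo (i, 0) (preactL i q.2) q.1, q.2)) ⁻¹' A))) with hT
  -- Bias and height are related by `τ = -(t + s) / ω_{ik}`; the Jacobian `|ω_{ik}|` of this affine
  -- map cancels the density of `coordMeasure`.
  have hset : (fun t : ℝ => (t, z)) ⁻¹' ((fun p : ℝ × (Fin m → ℝ) =>
      ((Function.update r (i, 0) p.1, p.2) : Params n (m + 1) × (Fin m → ℝ))) ⁻¹'
        ((fun q : Params n (m + 1) × (Fin m → ℝ) => (q.1, graphPt k q.1 i q.2)) ⁻¹' A)) =
      (fun t => t + s) ⁻¹' ((fun t => -(r (i, k.succ))⁻¹ * t) ⁻¹' T) := by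
    ext t
    simp only [hT, Set.mem_preimage, graphPt, height_update, slideTo_ins, ← hs]
    have h1 : -(r (i, k.succ) * (-(r (i, k.succ))⁻¹ * (t + s)) + s) = t := by
      field_simp
      ring
    have h2 : -(t + s) / r (i, k.succ) = -(r (i, k.succ))⁻¹ * (t + s) := by
      field_simp
    rw [h1, h2]
  have hinv : -(r (i, k.succ))⁻¹ ≠ 0 := neg_ne_zero.2 (inv_ne_zero hr)
  rw [hset, measure_preimage_add_right, Real.volume_preimage_mul_left hinv, ← mul_assoc,
    ← ENNReal.ofReal_mul (by positivity), inv_neg, inv_inv, abs_neg,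
    inv_mul_cancel₀ (abs_ne_zero.2 hr), ENNReal.ofReal_one, one_mul]

/-- As an embedding, `graphPt` transfers integrals without any measurability of `μ` and `u` on the
hyperplane. -/
theorem measurableEmbedding_graphPt (k : Fin (m + 1)) (r : Params n (m + 1)) (i : Fin n) :
    MeasurableEmbedding (graphPt k r i) := by
  refine (continuous_graphPt k r i).measurableEmbedding fun z w h => ?_
  ext j
  rw [← ins_succAbove k (height k r i z) z j, ← ins_succAbove k (height k r i w) w j]
  exact congrArg (fun x : E (m + 1) => x (k.succAbove j)) h

variable {Ω : Set (E (m + 1))} {μ u : E (m + 1) → ℝ}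

theorem integrableOn_breakingDelta_iff (hΩ : MeasurableSet Ω) (c₀ : ℝ) (c : Fin n → ℝ)
    {k : Fin (m + 1)} {r : Params n (m + 1)} {i : Fin n} (hk : r (i, k.succ) ≠ 0)
    (w : E (m + 1) → ℝ) :
    IntegrableOn (fun x => μ x * (network c₀ c r x - u x) * w x) Ω (breakingDelta r i) ↔
      Integrable fun z => residIntegrand Ω μ u c₀ c r w (graphPt k r i z) := by
  rw [← integrable_indicator_iff hΩ, breakingDelta_eq_map hk,
    integrable_smul_measure (by simpa using hk) ENNReal.ofReal_ne_top,
    (measurableEmbedding_graphPt k r i).integrable_map_iff]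
  rfl

theorem integral_breakingDelta_eq (hΩ : MeasurableSet Ω) (c₀ : ℝ) (c : Fin n → ℝ)
    {k : Fin (m + 1)} {r : Params n (m + 1)} {i : Fin n} (hk : r (i, k.succ) ≠ 0)
    (w : E (m + 1) → ℝ) :
    ∫ x in Ω, μ x * (network c₀ c r x - u x) * w x ∂(breakingDelta r i) =
      |r (i, k.succ)|⁻¹ * ∫ z, residIntegrand Ω μ u c₀ c r w (graphPt k r i z) := by
  rw [← integral_indicator hΩ, breakingDelta_eq_map hk, integral_smul_measure,
    (measurableEmbedding_graphPt k r i).integral_map, ENNReal.toReal_ofReal (by positivity)]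
  rfl

/-- The measure `δ(rᵢ · y) dr dx` on the product of parameter and physical space. -/
abbrev incidenceMeasure (n m : ℕ) (i : Fin n) :
    Measure (Params n m × E m) :=
  Measure.map (fun q : Params n m × E m => (slideTo (i, 0) (preactL i q.2) q.1, q.2))
    ((sliceMeasure ((i, 0) : Fin n × Fin (m + 1))).prod volume)

/-- Sliding changes only the parameters, so null sets of `x` stay null. Hence `μ` and `u`,
measurable only up to null sets, can be used on the incidence set. -/
theorem quasiMeasurePreserving_snd_incidence (i : Fin n) :
    Measure.QuasiMeasurePreserving Prod.snd (incidenceMeasure n m i) volume := by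
  refine ⟨measurable_snd, ?_⟩
  rw [Measure.map_map measurable_snd (measurable_slide i)]
  exact Measure.quasiMeasurePreserving_snd.absolutelyContinuous

theorem aestronglyMeasurable_incidence (hΩ_open : IsOpen Ω) (hμ : IntegrableOn μ Ω)
    (hu : AEStronglyMeasurable u (volume.restrict Ω)) (c₀ : ℝ) (c : Fin n → ℝ)
    {ν : Measure (Params n (m + 1) × E (m + 1))}
    (hν : Measure.QuasiMeasurePreserving Prod.snd ν volume)
    {w : E (m + 1) → ℝ} (hw : Continuous w) :
    AEStronglyMeasurable (fun q : Params n (m + 1) × E (m + 1) =>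
      residIntegrand Ω μ u c₀ c q.1 w q.2) ν := by
  have hΩ := hΩ_open.measurableSet
  have h1 : AEStronglyMeasurable (fun q : Params n (m + 1) × E (m + 1) => Ω.indicator μ q.2) ν :=
    ((aestronglyMeasurable_indicator_iff hΩ).2
      hμ.aestronglyMeasurable).comp_quasiMeasurePreserving hν
  have h2 : AEStronglyMeasurable (fun q : Params n (m + 1) × E (m + 1) => Ω.indicator u q.2) ν :=
    ((aestronglyMeasurable_indicator_iff hΩ).2 hu).comp_quasiMeasurePreserving hν
  have h3 := (h1.mul ((continuous_network c₀ c).aestronglyMeasurable.sub h2)).mul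
    (hw.comp continuous_snd).aestronglyMeasurable
  refine h3.congr (.of_forall fun q => ?_)
  by_cases hq : q.2 ∈ Ω
  · simp [residIntegrand, hq]
  · simp [residIntegrand, hq]

/-- Pulled back along the slide, the function is dominated by the indicator of a parameter ball
times `μ (1 + |u|)²`. The cutoff `χ` will be an indicator for local integrability and `φ` for the
weak identity. -/
theorem integrable_incidence (hΩ_open : IsOpen Ω) (hΩ_bdd : Bornology.IsBounded Ω)
    (hμ_nonneg : ∀ x ∈ Ω, 0 ≤ μ x) (hμ : IntegrableOn μ Ω)
    (hu : AEStronglyMeasurable u (volume.restrict Ω))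
    (hu_sq : IntegrableOn (fun x => μ x * u x ^ 2) Ω) (c₀ : ℝ) (c : Fin n → ℝ) (i : Fin n)
    {w : E (m + 1) → ℝ} (hw : Continuous w) {χ : Params n (m + 1) → ℝ} (hχ : Measurable χ) {M : ℝ}
    (hM : ∀ r, |χ r| ≤ M) {R : ℝ} (hR : ∀ r, r ∉ Metric.closedBall 0 R → χ r = 0) :
    Integrable (fun q : Params n (m + 1) × E (m + 1) =>
      χ q.1 * residIntegrand Ω μ u c₀ c q.1 w q.2) (incidenceMeasure n (m + 1) i) := by
  have hΩ := hΩ_open.measurableSet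
  have hm : AEStronglyMeasurable (fun q : Params n (m + 1) × E (m + 1) =>
      χ q.1 * residIntegrand Ω μ u c₀ c q.1 w q.2) (incidenceMeasure n (m + 1) i) :=
    (hχ.comp measurable_fst).aestronglyMeasurable.mul (aestronglyMeasurable_incidence hΩ_open hμ hu
      c₀ c (quasiMeasurePreserving_snd_incidence i) hw)
  rw [integrable_map_measure hm (measurable_slide i).aemeasurable]
  obtain ⟨C, hC1, hC⟩ := exists_network_bound (n := n) hΩ_bdd c₀ c
  obtain ⟨W, hW⟩ := hΩ_bdd.isCompact_closure.exists_bound_of_continuousOn hw.continuousOn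
  have hdom := (integrable_indicator_iff hΩ).2 (integrableOn_dominating hΩ hμ_nonneg hμ hu hu_sq)
  have hball : Integrable ((Metric.closedBall (0 : Params n (m + 1)) (max R 1)).indicator
      fun _ => (1 : ℝ)) (sliceMeasure ((i, 0) : Fin n × Fin (m + 1 + 1))) := by
    refine (integrable_indicator_iff measurableSet_closedBall).2 (integrableOn_const ?_)
    exact ((Measure.restrict_apply_le _ _).trans_lt measure_closedBall_lt_top).ne
  have hM0 : 0 ≤ M := (abs_nonneg _).trans (hM 0)
  refine Integrable.mono' ((hball.mul_prod hdom).const_mul (M * (C * (1 + |R|) * |W|)))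
    (hm.comp_measurable (measurable_slide i)) ?_
  have hae : ∀ᵐ q ∂((sliceMeasure ((i, 0) : Fin n × Fin (m + 1 + 1))).prod
      (volume : Measure (E (m + 1)))), q.1 (i, 0) ∈ Set.Icc (0 : ℝ) 1 :=
    Measure.quasiMeasurePreserving_fst.ae (ae_slice_mem (i, 0))
  filter_upwards [hae] with q hq
  simp only [Function.comp_apply]
  by_cases hx : q.2 ∈ Ω
  · by_cases hr : slideTo (i, 0) (preactL i q.2) q.1 ∈ Metric.closedBall 0 R
    · rw [Set.indicator_of_mem (mem_closedBall_of_update hq hr), Set.indicator_of_mem hx, one_mul,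
        norm_mul, mul_assoc M]
      refine mul_le_mul (hM _) ?_ (norm_nonneg _) hM0
      have h0 := hμ_nonneg _ hx
      rw [residIntegrand, Set.indicator_of_mem hx, norm_mul, norm_mul, Real.norm_of_nonneg h0]
      rw [mem_closedBall_zero_iff] at hr
      have h1 : |network c₀ c (slideTo (i, 0) (preactL i q.2) q.1) q.2 - u q.2| ≤
          C * (1 + |R|) * (1 + |u q.2|) := by
        refine (abs_sub _ _).trans ?_
        have e1 := (hC _ hx).2.2 (slideTo (i, 0) (preactL i q.2) q.1)
        have e2 : C * (1 + ‖slideTo (i, 0) (preactL i q.2) q.1‖) ≤ C * (1 + |R|) := by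
          have := hr.trans (le_abs_self R)
          gcongr
        have e3 : 1 ≤ C * (1 + |R|) := by nlinarith [abs_nonneg R]
        nlinarith [abs_nonneg (u q.2)]
      have h2 : ‖w q.2‖ ≤ |W| := (hW _ (subset_closure hx)).trans (le_abs_self _)
      have h4 : (1 + |u q.2|) ≤ (1 + |u q.2|) ^ 2 := by nlinarith [abs_nonneg (u q.2)]
      calc _ ≤ μ q.2 * (C * (1 + |R|) * (1 + |u q.2|)) * |W| := by
            refine mul_le_mul (mul_le_mul_of_nonneg_left h1 h0) h2 (norm_nonneg _) (by positivity)
        _ = C * (1 + |R|) * |W| * (μ q.2 * (1 + |u q.2|)) := by ring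
        _ ≤ _ := by gcongr
    · rw [hR _ hr, zero_mul, norm_zero]
      refine mul_nonneg (by positivity) (mul_nonneg (Set.indicator_nonneg (by simp) _) ?_)
      rw [Set.indicator_of_mem hx]
      have := hμ_nonneg _ hx
      positivity
  · rw [residIntegrand, Set.indicator_of_notMem hx, Set.indicator_of_notMem hx]
    simp

end Coarea

/-! ### Fubini for the residual entries and for parameter integrals -/

section Weak

variable {n m : ℕ} {Ω : Set (E (m + 1))} {μ u : E (m + 1) → ℝ}

theorem abs_indicator_one_le {α : Type*} (s : Set α) (a : α) :
    |s.indicator (fun _ => (1 : ℝ)) a| ≤ 1 := by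
  by_cases h : a ∈ s <;> simp [h]

/-- An entry of the residual matrix, as a function of the parameters. -/
def residualEntry (Ω : Set (E (m + 1))) (μ u : E (m + 1) → ℝ) (c₀ : ℝ)
    (c : Fin n → ℝ) (i : Fin n) (w : E (m + 1) → ℝ) (r : Params n (m + 1)) : ℝ :=
  ∫ x in Ω, μ x * (network c₀ c r x - u x) * w x ∂(breakingDelta r i)

theorem integrable_graph (hΩ_open : IsOpen Ω) (hΩ_bdd : Bornology.IsBounded Ω)
    (hμ_nonneg : ∀ x ∈ Ω, 0 ≤ μ x) (hμ : IntegrableOn μ Ω)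
    (hu : AEStronglyMeasurable u (volume.restrict Ω))
    (hu_sq : IntegrableOn (fun x => μ x * u x ^ 2) Ω) (c₀ : ℝ) (c : Fin n → ℝ) (i : Fin n)
    {w : E (m + 1) → ℝ} (hw : Continuous w) {χ : Params n (m + 1) → ℝ} (hχ : Measurable χ) {M : ℝ}
    (hM : ∀ r, |χ r| ≤ M) {R : ℝ} (hR : ∀ r, r ∉ Metric.closedBall 0 R → χ r = 0)
    (k : Fin (m + 1)) :
    Integrable (fun q : Params n (m + 1) × (Fin m → ℝ) =>
      χ q.1 * residIntegrand Ω μ u c₀ c q.1 w (graphPt k q.1 i q.2))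
      ((coordMeasure k i).prod volume) := by
  have h := integrable_incidence hΩ_open hΩ_bdd hμ_nonneg hμ hu hu_sq c₀ c i hw hχ hM hR
  rw [incidenceMeasure, ← map_graph_eq_map_slide k i] at h
  exact h.comp_measurable (measurable_graph k i)

/-- Fubini on the graph side, cut off to balls of integer radius. One coordinate chart suffices,
since its weight is nonzero for almost every `r`. -/
theorem ae_integrableOn_breakingDelta (hΩ_open : IsOpen Ω) (hΩ_bdd : Bornology.IsBounded Ω)
    (hμ_nonneg : ∀ x ∈ Ω, 0 ≤ μ x) (hμ : IntegrableOn μ Ω)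
    (hu : AEStronglyMeasurable u (volume.restrict Ω))
    (hu_sq : IntegrableOn (fun x => μ x * u x ^ 2) Ω) (c₀ : ℝ) (c : Fin n → ℝ) (i : Fin n)
    {w : E (m + 1) → ℝ} (hw : Continuous w) :
    ∀ᵐ r : Params n (m + 1),
      IntegrableOn (fun x => μ x * (network c₀ c r x - u x) * w x) Ω (breakingDelta r i) := by
  have h1 : ∀ N : ℕ, ∀ᵐ r : Params n (m + 1), Integrable fun z =>
      (Metric.closedBall (0 : Params n (m + 1)) N).indicator (fun _ => (1 : ℝ)) r *
        residIntegrand Ω μ u c₀ c r w (graphPt 0 r i z) := fun N =>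
    (volume_absolutelyContinuous_coordMeasure 0 i).ae_le
      (integrable_graph hΩ_open hΩ_bdd hμ_nonneg hμ hu hu_sq c₀ c i hw
        (χ := (Metric.closedBall (0 : Params n (m + 1)) N).indicator fun _ => (1 : ℝ))
        (measurable_const.indicator measurableSet_closedBall) (M := 1)
        (abs_indicator_one_le _)
        (fun r hr => Set.indicator_of_notMem hr _) 0).prod_right_ae
  filter_upwards [ae_all_iff.2 h1,
    ae_coord_ne_zero (ι := Fin n × Fin (m + 1 + 1)) (i, (0 : Fin (m + 1)).succ)] with r hr hk
  rw [integrableOn_breakingDelta_iff hΩ_open.measurableSet c₀ c hk w]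
  obtain ⟨N, hN⟩ := exists_nat_ge ‖r‖
  have h2 := hr N
  rw [Set.indicator_of_mem (by simpa using hN)] at h2
  simpa using h2

/-- Both sides are iterated integrals of one integrable function on the incidence set: through the
graph with `x` inside, through the slide with `r` inside. -/
theorem residualEntry_fubini (hΩ_open : IsOpen Ω) (hΩ_bdd : Bornology.IsBounded Ω)
    (hμ_nonneg : ∀ x ∈ Ω, 0 ≤ μ x) (hμ : IntegrableOn μ Ω)
    (hu : AEStronglyMeasurable u (volume.restrict Ω))
    (hu_sq : IntegrableOn (fun x => μ x * u x ^ 2) Ω) (c₀ : ℝ) (c : Fin n → ℝ) (i : Fin n)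
    {w : E (m + 1) → ℝ} (hw : Continuous w) {χ : Params n (m + 1) → ℝ} (hχ : Measurable χ) {M : ℝ}
    (hM : ∀ r, |χ r| ≤ M) {R : ℝ} (hR : ∀ r, r ∉ Metric.closedBall 0 R → χ r = 0) :
    Integrable (fun r => χ r * residualEntry Ω μ u c₀ c i w r) ∧
    IntegrableOn (fun x => ∫ r, χ (slideTo (i, 0) (preactL i x) r) *
      (μ x * (network c₀ c (slideTo (i, 0) (preactL i x) r) x - u x) * w x)
        ∂(sliceMeasure (i, 0))) Ω ∧
    ∫ r, χ r * residualEntry Ω μ u c₀ c i w r =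
      ∫ x in Ω, ∫ r, χ (slideTo (i, 0) (preactL i x) r) *
        (μ x * (network c₀ c (slideTo (i, 0) (preactL i x) r) x - u x) * w x)
          ∂(sliceMeasure (i, 0)) := by
  have hΩ := hΩ_open.measurableSet
  have hI := integrable_incidence hΩ_open hΩ_bdd hμ_nonneg hμ hu hu_sq c₀ c i hw hχ hM hR
  have hJ := integrable_graph hΩ_open hΩ_bdd hμ_nonneg hμ hu hu_sq c₀ c i hw hχ hM hR 0
  have hS := hI.comp_measurable (measurable_slide i)
  have hind : (fun x => ∫ r, χ (slideTo (i, 0) (preactL i x) r) *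
        residIntegrand Ω μ u c₀ c (slideTo (i, 0) (preactL i x) r) w x ∂(sliceMeasure (i, 0))) =
      Ω.indicator fun x => ∫ r, χ (slideTo (i, 0) (preactL i x) r) *
      (μ x * (network c₀ c (slideTo (i, 0) (preactL i x) r) x - u x) * w x)
        ∂(sliceMeasure (i, 0)) := by
    ext x
    by_cases hx : x ∈ Ω
    · simp [residIntegrand, hx]
    · simp [residIntegrand, hx]
  have hae : ∀ᵐ r : Params n (m + 1), (ENNReal.ofReal |r (i, (0 : Fin (m + 1)).succ)|⁻¹).toReal •
      ∫ z, χ r * residIntegrand Ω μ u c₀ c r w (graphPt 0 r i z) =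
        χ r * residualEntry Ω μ u c₀ c i w r := by
    filter_upwards [ae_coord_ne_zero (ι := Fin n × Fin (m + 1 + 1)) (i, (0 : Fin (m + 1)).succ)]
      with r hk
    rw [residualEntry, integral_breakingDelta_eq hΩ c₀ c hk w, integral_const_mul,
      ENNReal.toReal_ofReal (by positivity), smul_eq_mul]
    ring
  refine ⟨?_, ?_, ?_⟩
  · have h1 := (integrable_withDensity_iff_integrable_smul' (measurable_coordDensity 0 i)
      (.of_forall fun r => ENNReal.ofReal_lt_top)).1 hJ.integral_prod_left
    exact h1.congr hae
  · rw [← integrable_indicator_iff hΩ, ← hind]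
    exact hS.integral_prod_right
  · rw [← integral_indicator hΩ, ← hind, ← integral_congr_ae hae,
      ← integral_withDensity_eq_integral_toReal_smul (measurable_coordDensity 0 i)
        (.of_forall fun r => ENNReal.ofReal_lt_top)]
    have h1 := integral_prod _ hJ
    have h2 := integral_prod_symm _ hS
    have h3 := integral_map (measurable_graph 0 i).aemeasurable (μ := (coordMeasure 0 i).prod volume)
      (f := fun q : Params n (m + 1) × E (m + 1) =>
        χ q.1 * residIntegrand Ω μ u c₀ c q.1 w q.2)
      (by rw [map_graph_eq_map_slide]; exact hI.aestronglyMeasurable)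
    have h4 := integral_map (measurable_slide i).aemeasurable hI.aestronglyMeasurable
    rw [map_graph_eq_map_slide, h4] at h3
    exact h1.symm.trans (h3.symm.trans h2)

theorem integrable_params_prod (hΩ_open : IsOpen Ω) {h : E (m + 1) → ℝ} (hh : IntegrableOn h Ω)
    {G : Params n (m + 1) → E (m + 1) → ℝ}
    (hG : AEStronglyMeasurable (fun q : Params n (m + 1) × E (m + 1) => G q.1 q.2)
      (volume.prod (volume.restrict Ω)))
    {χ : Params n (m + 1) → ℝ} (hχ : Measurable χ) {M : ℝ}
    (hM : ∀ r, |χ r| ≤ M) {R : ℝ} (hR : ∀ r, r ∉ Metric.closedBall 0 R → χ r = 0) {C : ℝ}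
    (hC : ∀ r ∈ Metric.closedBall (0 : Params n (m + 1)) R, ∀ x ∈ Ω, |G r x| ≤ C * h x) :
    Integrable (fun q : Params n (m + 1) × E (m + 1) => χ q.1 * G q.1 q.2)
      (volume.prod (volume.restrict Ω)) := by
  have hball : Integrable ((Metric.closedBall (0 : Params n (m + 1)) R).indicator
      fun _ => (1 : ℝ)) := (integrable_indicator_iff measurableSet_closedBall).2
        (integrableOn_const measure_closedBall_lt_top.ne)
  have hM0 : 0 ≤ M := (abs_nonneg _).trans (hM 0)
  refine Integrable.mono' ((hball.mul_prod hh).const_mul (M * C))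
    ((hχ.comp measurable_fst).aestronglyMeasurable.mul hG) ?_
  have hae : ∀ᵐ q ∂((volume : Measure (Params n (m + 1))).prod (volume.restrict Ω)), q.2 ∈ Ω :=
    Measure.quasiMeasurePreserving_snd.ae (ae_restrict_mem hΩ_open.measurableSet)
  filter_upwards [hae] with q hq
  by_cases hr : q.1 ∈ Metric.closedBall (0 : Params n (m + 1)) R
  · rw [Set.indicator_of_mem hr, one_mul, norm_mul, mul_assoc]
    exact mul_le_mul (hM _) (hC _ hr _ hq) (norm_nonneg _) hM0
  · rw [hR _ hr, Set.indicator_of_notMem hr]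
    simp

theorem params_fubini (hΩ_open : IsOpen Ω) {h : E (m + 1) → ℝ} (hh : IntegrableOn h Ω)
    {G : Params n (m + 1) → E (m + 1) → ℝ}
    (hG : AEStronglyMeasurable (fun q : Params n (m + 1) × E (m + 1) => G q.1 q.2)
      (volume.prod (volume.restrict Ω)))
    {χ : Params n (m + 1) → ℝ} (hχ : Measurable χ) {M : ℝ}
    (hM : ∀ r, |χ r| ≤ M) {R : ℝ} (hR : ∀ r, r ∉ Metric.closedBall 0 R → χ r = 0) {C : ℝ}
    (hC : ∀ r ∈ Metric.closedBall (0 : Params n (m + 1)) R, ∀ x ∈ Ω, |G r x| ≤ C * h x) :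
    Integrable (fun r => χ r * ∫ x in Ω, G r x) ∧
    IntegrableOn (fun x => ∫ r, χ r * G r x) Ω ∧
    ∫ r, χ r * ∫ x in Ω, G r x = ∫ x in Ω, ∫ r, χ r * G r x := by
  have hI := integrable_params_prod hΩ_open hh hG hχ hM hR hC
  refine ⟨?_, hI.integral_prod_right, ?_⟩
  · simpa only [integral_const_mul] using hI.integral_prod_left
  · rw [← integral_integral_swap hI]
    simp only [integral_const_mul]

theorem locallyIntegrable_of_cutoff {F : Params n m → ℝ}
    (h : ∀ (χ : Params n m → ℝ) (R : ℝ), Measurable χ → (∀ r, |χ r| ≤ 1) →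
      (∀ r, r ∉ Metric.closedBall 0 R → χ r = 0) → Integrable fun r => χ r * F r) :
    LocallyIntegrable F := by
  rw [locallyIntegrable_iff]
  intro K hK
  obtain ⟨R, hR⟩ := hK.isBounded.subset_closedBall (0 : Params n m)
  rw [← integrable_indicator_iff hK.measurableSet]
  refine (h (K.indicator fun _ => 1) R (measurable_const.indicator hK.measurableSet)
    (abs_indicator_one_le _)
    (fun r hr => Set.indicator_of_notMem (fun h => hr (hR h)) _)).congr (.of_forall fun r => ?_)
  by_cases hr : r ∈ K
  · simp [hr]
  · simp [hr]

end Weak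

/-! ### The weak Hessian of the loss -/

section WeakHessian

variable {n m : ℕ} {Ω : Set (E (m + 1))} {μ u : E (m + 1) → ℝ}

theorem ae_weight_ne_zero : ∀ᵐ r : Params n (m + 1), ∀ i, weight r i ≠ 0 := by
  refine ae_all_iff.2 fun i => ?_
  filter_upwards [ae_coord_ne_zero (ι := Fin n × Fin (m + 1 + 1)) (i, (0 : Fin (m + 1)).succ)]
    with r hr h
  exact hr (by simpa [weight] using congrArg (fun v => v 0) h)

theorem loss_fubini (hΩ_open : IsOpen Ω) (hΩ_bdd : Bornology.IsBounded Ω)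
    (hμ_nonneg : ∀ x ∈ Ω, 0 ≤ μ x) (hμ : IntegrableOn μ Ω)
    (hu : AEStronglyMeasurable u (volume.restrict Ω))
    (hu_sq : IntegrableOn (fun x => μ x * u x ^ 2) Ω) (c₀ : ℝ) (c : Fin n → ℝ)
    {χ : Params n (m + 1) → ℝ} (hχ : Measurable χ) {M : ℝ}
    (hM : ∀ r, |χ r| ≤ M) {R : ℝ} (hR : ∀ r, r ∉ Metric.closedBall 0 R → χ r = 0) :
    Integrable (fun r => χ r * loss Ω μ u c₀ c r) ∧
    ∫ r, χ r * loss Ω μ u c₀ c r =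
      ∫ x in Ω, ∫ r, χ r * (μ x * (1 / 2 * (network c₀ c r x - u x) ^ 2)) := by
  have hΩ := hΩ_open.measurableSet
  obtain ⟨C, hC1, hC⟩ := exists_network_bound (n := n) hΩ_bdd c₀ c
  have hm : AEStronglyMeasurable (fun q : Params n (m + 1) × E (m + 1) =>
      μ q.2 * (1 / 2 * (network c₀ c q.1 q.2 - u q.2) ^ 2))
      (volume.prod (volume.restrict Ω)) :=
    hμ.aestronglyMeasurable.comp_snd.mul
      ((((continuous_network c₀ c).aestronglyMeasurable.sub hu.comp_snd).pow 2).const_mul _)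
  have h := params_fubini hΩ_open (integrableOn_dominating hΩ hμ_nonneg hμ hu hu_sq)
    (G := fun r x => μ x * (1 / 2 * (network c₀ c r x - u x) ^ 2)) hm hχ hM hR
    (C := (C * (1 + |R|)) ^ 2) (fun r hr x hx => ?_)
  · simp only [loss_eq hΩ hμ_nonneg c₀ c]
    exact ⟨h.1, h.2.2⟩
  · have h0 := hμ_nonneg x hx
    rw [mem_closedBall_zero_iff] at hr
    have h1 : |network c₀ c r x - u x| ≤ C * (1 + |R|) * (1 + |u x|) := by
      refine (abs_sub _ _).trans ?_
      have e1 := (hC _ hx).2.2 r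
      have e2 : C * (1 + ‖r‖) ≤ C * (1 + |R|) := by
        have := hr.trans (le_abs_self R)
        gcongr
      have e3 : 1 ≤ C * (1 + |R|) := by nlinarith [abs_nonneg R]
      nlinarith [abs_nonneg (u x)]
    have h2 := pow_le_pow_left₀ (abs_nonneg _) h1 2
    rw [sq_abs, mul_pow] at h2
    rw [abs_of_nonneg (by positivity)]
    have h3 := mul_le_mul_of_nonneg_left h2 h0
    nlinarith [mul_nonneg h0 (sq_nonneg (network c₀ c r x - u x))]

theorem layerGN_fubini (hΩ_open : IsOpen Ω) (hΩ_bdd : Bornology.IsBounded Ω)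
    (hμ_nonneg : ∀ x ∈ Ω, 0 ≤ μ x) (hμ : IntegrableOn μ Ω) (a b : Fin n × Fin (m + 1 + 1))
    {χ : Params n (m + 1) → ℝ} (hχ : Measurable χ) {M : ℝ}
    (hM : ∀ r, |χ r| ≤ M) {R : ℝ} (hR : ∀ r, r ∉ Metric.closedBall 0 R → χ r = 0) :
    Integrable (fun r => χ r * layerGN Ω μ r a b) ∧
    IntegrableOn (fun x => ∫ r, χ r * (μ x * (heaviside (preact r a.1 x) *
      heaviside (preact r b.1 x) * (homog x a.2 * homog x b.2)))) Ω ∧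
    ∫ r, χ r * layerGN Ω μ r a b =
      ∫ x in Ω, ∫ r, χ r * (μ x * (heaviside (preact r a.1 x) * heaviside (preact r b.1 x) *
        (homog x a.2 * homog x b.2))) := by
  obtain ⟨C, hC1, hC⟩ := exists_network_bound (n := n) hΩ_bdd 0 0
  have hH : ∀ i, Measurable fun q : Params n (m + 1) × E (m + 1) =>
      heaviside (preact q.1 i q.2) := fun i =>
    measurable_heaviside.comp (continuous_preact i).measurable
  have hy : ∀ k, Measurable fun q : Params n (m + 1) × E (m + 1) => homog q.2 k := fun k =>
    ((continuous_homog k).comp continuous_snd).measurable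
  have hm : AEStronglyMeasurable (fun q : Params n (m + 1) × E (m + 1) =>
      μ q.2 * (heaviside (preact q.1 a.1 q.2) * heaviside (preact q.1 b.1 q.2) *
        (homog q.2 a.2 * homog q.2 b.2))) (volume.prod (volume.restrict Ω)) :=
    hμ.aestronglyMeasurable.comp_snd.mul
      (((hH a.1).mul (hH b.1)).mul ((hy a.2).mul (hy b.2))).aestronglyMeasurable
  simp only [layerGN_apply]
  refine params_fubini hΩ_open hμ (G := fun r x => μ x * (heaviside (preact r a.1 x) *
    heaviside (preact r b.1 x) * (homog x a.2 * homog x b.2))) hm hχ hM hR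
    (C := C * C) (fun r _ x hx => ?_)
  have h0 := hμ_nonneg x hx
  rw [abs_mul, abs_of_nonneg h0, mul_comm (C * C), abs_mul, abs_mul, abs_mul]
  refine mul_le_mul_of_nonneg_left ?_ h0
  have h1 : |heaviside (preact r a.1 x)| * |heaviside (preact r b.1 x)| ≤ 1 :=
    mul_le_one₀ (abs_heaviside_le_one _) (abs_nonneg _) (abs_heaviside_le_one _)
  have h2 : |homog x a.2| * |homog x b.2| ≤ C * C :=
    mul_le_mul ((hC x hx).1 _) ((hC x hx).1 _) (abs_nonneg _) (by linarith)
  calc _ ≤ 1 * (C * C) := mul_le_mul h1 h2 (by positivity) zero_le_one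
    _ = _ := one_mul _

theorem residualMatrix_eq_residualEntry (c₀ : ℝ) (c : Fin n → ℝ) (r : Params n (m + 1))
    (a b : Fin n × Fin (m + 1 + 1)) :
    residualMatrix Ω μ u c₀ c r a b = if a.1 = b.1 then
      residualEntry Ω μ u c₀ c a.1 (fun x => homog x a.2 * homog x b.2) r else 0 :=
  residualMatrix_apply Ω μ u c₀ c r a b

theorem ae_residualIntegrable (hΩ_open : IsOpen Ω) (hΩ_bdd : Bornology.IsBounded Ω)
    (hμ_nonneg : ∀ x ∈ Ω, 0 ≤ μ x) (hμ : IntegrableOn μ Ω)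
    (hu : AEStronglyMeasurable u (volume.restrict Ω))
    (hu_sq : IntegrableOn (fun x => μ x * u x ^ 2) Ω) (c₀ : ℝ) (c : Fin n → ℝ) :
    ∀ᵐ r : Params n (m + 1), ResidualIntegrable Ω μ u c₀ c r := by
  simp only [residualIntegrable_iff]
  exact ae_all_iff.2 fun i => ae_all_iff.2 fun k => ae_all_iff.2 fun l =>
    ae_integrableOn_breakingDelta hΩ_open hΩ_bdd hμ_nonneg hμ hu hu_sq c₀ c i
      ((continuous_homog k).mul (continuous_homog l))

theorem hessianMatrix_cutoff (hΩ_open : IsOpen Ω) (hΩ_bdd : Bornology.IsBounded Ω)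
    (hμ_nonneg : ∀ x ∈ Ω, 0 ≤ μ x) (hμ : IntegrableOn μ Ω)
    (hu : AEStronglyMeasurable u (volume.restrict Ω))
    (hu_sq : IntegrableOn (fun x => μ x * u x ^ 2) Ω) (c₀ : ℝ) (c : Fin n → ℝ)
    (a b : Fin n × Fin (m + 1 + 1)) {χ : Params n (m + 1) → ℝ} (hχ : Measurable χ) {M : ℝ}
    (hM : ∀ r, |χ r| ≤ M) {R : ℝ} (hR : ∀ r, r ∉ Metric.closedBall 0 R → χ r = 0) :
    Integrable (fun r => χ r *
      (gaussNewton Ω μ c₀ c r + residualMatrix Ω μ u c₀ c r * scaling (m + 1) c) a b) ∧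
    ∫ r, χ r *
      (gaussNewton Ω μ c₀ c r + residualMatrix Ω μ u c₀ c r * scaling (m + 1) c) a b =
    (c a.1 * c b.1 * ∫ r, χ r * layerGN Ω μ r a b) + if a.1 = b.1 then
      c b.1 * ∫ r, χ r *
        residualEntry Ω μ u c₀ c a.1 (fun x => homog x a.2 * homog x b.2) r else 0 := by
  have hL := (layerGN_fubini hΩ_open hΩ_bdd hμ_nonneg hμ a b hχ hM hR).1.const_mul
    (c a.1 * c b.1)
  have hw : Continuous fun x : E (m + 1) => homog x a.2 * homog x b.2 :=
    (continuous_homog a.2).mul (continuous_homog b.2)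
  have hE := (residualEntry_fubini hΩ_open hΩ_bdd hμ_nonneg hμ hu hu_sq c₀ c a.1 hw hχ hM hR).1.const_mul (c b.1)
  by_cases hab : a.1 = b.1
  · have hae : ∀ᵐ r : Params n (m + 1), c a.1 * c b.1 * (χ r * layerGN Ω μ r a b) +
        c b.1 * (χ r * residualEntry Ω μ u c₀ c a.1 (fun x => homog x a.2 * homog x b.2) r) =
        χ r *
        (gaussNewton Ω μ c₀ c r + residualMatrix Ω μ u c₀ c r * scaling (m + 1) c) a b := by
      filter_upwards [ae_weight_ne_zero] with r hr
      rw [hessianMatrix_apply Ω μ u c₀ c hr, residualMatrix_eq_residualEntry, if_pos hab]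
      ring
    refine ⟨(hL.add hE).congr hae, ?_⟩
    rw [← integral_congr_ae hae, integral_add hL hE, integral_const_mul, integral_const_mul,
      if_pos hab]
  · have hae : ∀ᵐ r : Params n (m + 1), c a.1 * c b.1 * (χ r * layerGN Ω μ r a b) = χ r *
        (gaussNewton Ω μ c₀ c r + residualMatrix Ω μ u c₀ c r * scaling (m + 1) c) a b := by
      filter_upwards [ae_weight_ne_zero] with r hr
      rw [hessianMatrix_apply Ω μ u c₀ c hr, residualMatrix_eq_residualEntry, if_neg hab]
      ring
    refine ⟨hL.congr hae, ?_⟩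
    rw [← integral_congr_ae hae, integral_const_mul, if_neg hab, add_zero]

/-- After interchanging the integrals over `r` and `x` on both sides, the claim is the pointwise
identity `integral_sq_network_mul_hessian` with `t = u x`, weighted by `μ`. -/
theorem integral_loss_mul_hessian (hΩ_open : IsOpen Ω) (hΩ_bdd : Bornology.IsBounded Ω)
    (hμ_nonneg : ∀ x ∈ Ω, 0 ≤ μ x) (hμ : IntegrableOn μ Ω)
    (hu : AEStronglyMeasurable u (volume.restrict Ω))
    (hu_sq : IntegrableOn (fun x => μ x * u x ^ 2) Ω) (c₀ : ℝ) (c : Fin n → ℝ)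
    {φ : Params n (m + 1) → ℝ} (hφ : ContDiff ℝ ∞ φ) (hc : HasCompactSupport φ)
    (a b : Fin n × Fin (m + 1 + 1)) :
    ∫ r, loss Ω μ u c₀ c r * hessian φ r a b = ∫ r,
      (gaussNewton Ω μ c₀ c r + residualMatrix Ω μ u c₀ c r * scaling (m + 1) c) a b * φ r := by
  obtain ⟨R, hR⟩ := hc.isCompact.isBounded.subset_closedBall (0 : Params n (m + 1))
  have hφ0 : ∀ r, r ∉ Metric.closedBall 0 R → φ r = 0 := fun r hr =>
    image_eq_zero_of_notMem_tsupport fun h => hr (hR h)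
  have hφ2 : Continuous fun r => hessian φ r a b := by
    have h1 : ContDiff ℝ ∞ (fderiv ℝ (fderiv ℝ φ)) :=
      (hφ.fderiv_right (m := ∞) (by simp)).fderiv_right (by simp)
    exact (h1.continuous.clm_apply continuous_const).clm_apply continuous_const
  have hcs : HasCompactSupport fun r => hessian φ r a b :=
    ((hc.fderiv ℝ).fderiv ℝ).comp_left
      (g := fun L : Params n (m + 1) →L[ℝ] Params n (m + 1) →L[ℝ] ℝ =>
        L (Pi.single a 1) (Pi.single b 1)) rfl
  obtain ⟨R', hR'⟩ := hcs.isCompact.isBounded.subset_closedBall (0 : Params n (m + 1))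
  have hφ20 : ∀ r, r ∉ Metric.closedBall 0 R' → hessian φ r a b = 0 := fun r hr =>
    image_eq_zero_of_notMem_tsupport (f := fun r => hessian φ r a b) fun h => hr (hR' h)
  obtain ⟨M, hM⟩ := hφ.continuous.bounded_above_of_compact_support hc
  obtain ⟨M', hM'⟩ := hφ2.bounded_above_of_compact_support hcs
  have hφm := hφ.continuous.measurable
  have hw : Continuous fun x : E (m + 1) => homog x a.2 * homog x b.2 :=
    (continuous_homog a.2).mul (continuous_homog b.2)
  have hA := layerGN_fubini hΩ_open hΩ_bdd hμ_nonneg hμ a b hφm hM hφ0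
  have hB := residualEntry_fubini hΩ_open hΩ_bdd hμ_nonneg hμ hu hu_sq c₀ c a.1 hw hφm hM hφ0
  simp_rw [mul_comm (loss Ω μ u c₀ c _), mul_comm _ (φ _)]
  rw [(loss_fubini hΩ_open hΩ_bdd hμ_nonneg hμ hu hu_sq c₀ c hφ2.measurable hM' hφ20).2,
    (hessianMatrix_cutoff hΩ_open hΩ_bdd hμ_nonneg hμ hu hu_sq c₀ c a b hφm hM hφ0).2,
    hA.2.2, hB.2.2]
  have hpt : ∀ x, ∫ r, hessian φ r a b * (μ x * (1 / 2 * (network c₀ c r x - u x) ^ 2)) =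
      (c a.1 * c b.1 * ∫ r, φ r * (μ x * (heaviside (preact r a.1 x) *
        heaviside (preact r b.1 x) * (homog x a.2 * homog x b.2)))) +
      if a.1 = b.1 then c b.1 * ∫ r, φ (slideTo (a.1, 0) (preactL a.1 x) r) *
        (μ x * (network c₀ c (slideTo (a.1, 0) (preactL a.1 x) r) x - u x) *
          (homog x a.2 * homog x b.2)) ∂(sliceMeasure (a.1, 0)) else 0 := by
    intro x
    have h1 := congrArg (fun t => μ x * t)
      (integral_sq_network_mul_hessian c₀ c x (u x) hφ hc a b)
    simp only [mul_add, mul_ite, mul_zero, ← integral_const_mul] at h1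
    simp only [← integral_const_mul]
    refine Eq.trans (integral_congr_ae (.of_forall fun r => ?_)) (h1.trans ?_)
    · dsimp only; ring
    · refine congrArg₂ (· + ·) (integral_congr_ae (.of_forall fun r => by dsimp only; ring)) ?_
      by_cases hab : a.1 = b.1
      · simp only [if_pos hab]
        exact integral_congr_ae (.of_forall fun r => by dsimp only; ring)
      · simp only [if_neg hab]
  simp_rw [hpt]
  by_cases hab : a.1 = b.1
  · simp only [if_pos hab]
    rw [integral_add (hA.2.1.const_mul _) (hB.2.1.const_mul _), integral_const_mul,
      integral_const_mul]
  · simp only [if_neg hab, add_zero]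
    rw [integral_const_mul]

theorem isWeakHessian_loss (hΩ_open : IsOpen Ω) (hΩ_bdd : Bornology.IsBounded Ω)
    (hμ_nonneg : ∀ x ∈ Ω, 0 ≤ μ x) (hμ : IntegrableOn μ Ω)
    (hu : AEStronglyMeasurable u (volume.restrict Ω))
    (hu_sq : IntegrableOn (fun x => μ x * u x ^ 2) Ω) (c₀ : ℝ) (c : Fin n → ℝ) :
    IsWeakHessian (fun r : Params n (m + 1) => loss Ω μ u c₀ c r)
      (fun r => gaussNewton Ω μ c₀ c r + residualMatrix Ω μ u c₀ c r * scaling (m + 1) c) where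
  locallyIntegrable := locallyIntegrable_of_cutoff fun _ _ hχ h1 h0 =>
    (loss_fubini hΩ_open hΩ_bdd hμ_nonneg hμ hu hu_sq c₀ c hχ h1 h0).1
  locallyIntegrable_entry a b := locallyIntegrable_of_cutoff fun _ _ hχ h1 h0 =>
    (hessianMatrix_cutoff hΩ_open hΩ_bdd hμ_nonneg hμ hu hu_sq c₀ c a b hχ h1 h0).1
  integral_eq _ hφ hc a b :=
    integral_loss_mul_hessian hΩ_open hΩ_bdd hμ_nonneg hμ hu hu_sq c₀ c hφ hc a b

end WeakHessian

end SgGN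

end

open SgGN in
theorem mainTheorem3 {n d : ℕ} (hd : 0 < d)
    (Ω : Set (E d)) (hΩ_open : IsOpen Ω) (hΩ_bdd : Bornology.IsBounded Ω)
    (μ u : E d → ℝ)
    (hμ_nonneg : ∀ x ∈ Ω, 0 ≤ μ x) (hμ : IntegrableOn μ Ω)
    (hu : AEStronglyMeasurable u (volume.restrict Ω))
    (hu_sq : IntegrableOn (fun x => μ x * u x ^ 2) Ω)
    (c₀ : ℝ) (c : Fin n → ℝ) :
    -- factorization of the Gauss-Newton matrix
    (∀ r : Params n d, (∀ i, weight r i ≠ 0) →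
      (∀ᵐ x ∂(volume.restrict Ω),
        DifferentiableAt ℝ (fun s : Params n d => network c₀ c s x) r) ∧
      gaussNewton Ω μ c₀ c r = scaling d c * layerGN Ω μ r * scaling d c) ∧
    -- the Hessian in the weak sense
    ((∀ᵐ r : Params n d, ResidualIntegrable Ω μ u c₀ c r) ∧
      IsWeakHessian (fun r : Params n d => loss Ω μ u c₀ c r)
        (fun r => gaussNewton Ω μ c₀ c r + residualMatrix Ω μ u c₀ c r * scaling d c)) ∧
    -- the Hessian in the classical sense
    ((∃ K : ℝ, ∀ x ∈ Ω, |μ x| ≤ K ∧ |u x| ≤ K) →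
      ∀ r : Params n d, (∀ i, weight r i ≠ 0) →
      (∀ i, ∀ᵐ x ∂(breakingDelta r i),
        x ∉ frontier Ω ∧ (x ∈ Ω → ContinuousAt μ x ∧ ContinuousAt u x)) →
      ResidualIntegrable Ω μ u c₀ c r ∧
      (∀ᶠ s in 𝓝 r, DifferentiableAt ℝ (fun s : Params n d => loss Ω μ u c₀ c s) s) ∧
      DifferentiableAt ℝ (fderiv ℝ (fun s : Params n d => loss Ω μ u c₀ c s)) r ∧
      hessian (fun s : Params n d => loss Ω μ u c₀ c s) r =
        gaussNewton Ω μ c₀ c r + residualMatrix Ω μ u c₀ c r * scaling d c) := by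
  -- The graph charts need one coordinate to split off.
  obtain ⟨m, rfl⟩ : ∃ m, d = m + 1 := ⟨d - 1, by omega⟩
  refine ⟨fun r hr => ⟨?_, gaussNewton_factorization Ω μ c₀ c hr⟩,
    ⟨ae_residualIntegrable hΩ_open hΩ_bdd hμ_nonneg hμ hu hu_sq c₀ c,
      isWeakHessian_loss hΩ_open hΩ_bdd hμ_nonneg hμ hu hu_sq c₀ c⟩, ?_⟩
  · refine ae_restrict_of_ae ?_
    filter_upwards [ae_preact_ne_zero hr] with x hx
    exact (hasFDerivAt_network c₀ c hx).differentiableAt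
  · rintro ⟨K, hK⟩ r hr hcont
    exact ⟨residualIntegrable_of_continuousAt hΩ_open hΩ_bdd hμ hu hK c₀ c hr hcont,
      classical_hessian hΩ_open hΩ_bdd hμ_nonneg hμ hu hu_sq hK c₀ c hr hcont⟩
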